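/- **Definitions.** Strings are elements of $2^{<\omega}$, sequences are elements of $2^\omega$; $\lambda$ is Lebesgue measure on $2^\omega$. A *Turing functional* $\Phi$ is given by a computably enumerated set of pairs of strings such that whenever $(\sigma,\tau),(\sigma',\tau')$ are enumerated and $\sigma\preceq\sigma'$, the strings $\tau,\tau'$ are comparable; $\Phi^Y$ is the union of all $\tau$ with $(Y\upharpoonright n,\tau)$ enumerated for some $n$, and $\Phi^Y_s$ is the part of it given by the pairs enumerated in fewer than $s$ steps. $\Phi$ is a *tt-functional* if $\Phi^Y$ is infinite for all $Y$, and $X\le_{tt}Y$ if $X=\Phi^Y$ for some tt-functional $\Phi$. A sequence $X$ is *weakly deep* if $X\not\le_{tt}Y$ for every Martin-Löf random $Y$ (random with respect to $\lambda$). A *continuous semimeasure* is a function $P:2^{<\omega}\to[0,1]$ with $P(\varnothing)\le 1$ and $P(\sigma)\ge P(\sigma0)+P(\sigma1)$ for all $\sigma$. It is *computable* if its values are computable reals uniformly in $\sigma$, and *lower semicomputable* if each $P(\sigma)$ is the limit of a nondecreasing sequence of rationals that is computable uniformly in $\sigma$. Let $\mathbf M$ be a universal continuous semimeasure, that is, a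 lower semicomputable continuous semimeasure such that for every lower semicomputable continuous semimeasure $P$ there is a constant $c$ with $P\le c\,\mathbf M$. Put $\mathit{KA}(\sigma)=-\log_2\mathbf M(\sigma)$. Let $U$ be a universal Turing functional (universal monotone machine): for every Turing functional $\Psi$ there is a string $\rho$ with $U^{\rho Y}=\Psi^Y$ for all $Y$. A *time bound* is a nondecreasing function $t:\omega\to\omega$. For a computable time bound $t$, the time-bounded a priori probability $\mathbf M^t$ is the probability that $U$ outputs $\sigma$ in time, where every prefix of $\sigma$ has to be output within the time allowed for its length: $$\mathbf M^t(\sigma)=\lambda\{Y:\ U^Y_{t(i)}\succeq\sigma\upharpoonright i\ \text{ for all } i\le|\sigma|\},$$ and $\mathit{KA}^t(\sigma)=-\log_2\mathbf M^t(\sigma)$ (with $-\log_2 0=\infty$). A sequence $X$ is *$\mathit{KA}$-deep* if $\mathit{KA}^t(X\upharpoonright n)-\mathit{KA}(X\upharpoonright n)\to\infty$ as $n\to\infty$ for every computable time bound $t$. **Theorem.** For all $\mathbf M$ and $U$ as above and every $X\in2^\omega$: 1. $X$ is weakly deep if and only if for every computable continuous semimeasure $P$, $$\frac{\mathbf M(X\upharpoonright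 n)}{P(X\upharpoonright n)}\to\infty\qquad(n\to\infty),$$ where the ratio is $\infty$ when $P(X\upharpoonright n)=0$ (note that $\mathbf M>0$ everywhere). 2. $X$ is $\mathit{KA}$-deep if and only if $X$ is weakly deep. -/

import Mathlib

open MeasureTheory Filter Topology
open scoped ENNReal

namespace Depth

/-! ### Cantor space and strings -/

/-- Infinite binary sequences. -/
abbrev Cantor : Type := ℕ → Bool

/-- The prefix of `X` of length `n`. -/
def prefixOf (X : Cantor) (n : ℕ) : List Bool := (List.range n).map X

/-- The sequence `ρ Y`: the string `ρ` followed by the sequence `Y`. -/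
def prepend (ρ : List Bool) (Y : Cantor) : Cantor :=
  fun n => (ρ[n]?).getD (Y (n - ρ.length))

/-- Lebesgue measure (the fair coin measure) on Cantor space. -/
noncomputable def lebesgue : Measure Cantor :=
  Measure.infinitePi (fun _ : ℕ => (PMF.uniformOfFintype Bool).toMeasure)

/-! ### Turing functionals, truth-table reducibility -/

/-- A Turing functional: a c.e. set of pairs of strings, given by a computable enumeration
(`none` means that nothing is enumerated at that step), in which comparable inputs have comparable
outputs. -/
structure TuringFunctional where
  enum : ℕ → Option (List Bool × List Bool)
  computable : Computable enum
  consistent : ∀ j k σ τ σ' τ', enum j = some (σ, τ) → enum k = some (σ', τ') →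
    σ <+: σ' → τ <+: τ' ∨ τ' <+: τ

/-- Within `s` steps the functional, with oracle `Y`, has produced an output that extends `τ`
(the empty output is there from the beginning). -/
def TuringFunctional.OutputsBy (Φ : TuringFunctional) (s : ℕ) (Y : Cantor) (τ : List Bool) : Prop :=
  τ = [] ∨ ∃ k < s, ∃ n τ', Φ.enum k = some (prefixOf Y n, τ') ∧ τ <+: τ'

/-- The string `τ` is a prefix of the (finite or infinite) output `Φ^Y`. -/
def TuringFunctional.Outputs (Φ : TuringFunctional) (Y : Cantor) (τ : List Bool) : Prop :=
  ∃ s, Φ.OutputsBy s Y τ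

/-- `Φ^Y` is the infinite sequence `X`. -/
def TuringFunctional.Computes (Φ : TuringFunctional) (Y X : Cantor) : Prop :=
  ∀ n, Φ.Outputs Y (prefixOf X n)

/-- A tt-functional is a Turing functional that is total on all oracles. -/
def TuringFunctional.IsTT (Φ : TuringFunctional) : Prop :=
  ∀ Y, ∃ X, Φ.Computes Y X

/-- `X` is truth-table reducible to `Y`. -/
def TTReducible (X Y : Cantor) : Prop :=
  ∃ Φ : TuringFunctional, Φ.IsTT ∧ Φ.Computes Y X

/-! ### Martin-Löf randomness and weak depth -/

/-- The open subset of Cantor space generated by a set of strings. -/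
def openOf (W : List Bool → Prop) : Set Cantor := {X | ∃ n, W (prefixOf X n)}

/-- A Martin-Löf test with respect to Lebesgue measure: the `i`-th open set is `openOf (W i)`. -/
def IsMLTest (W : ℕ → List Bool → Prop) : Prop :=
  REPred (fun p : ℕ × List Bool => W p.1 p.2) ∧
    ∀ i, lebesgue (openOf (W i)) ≤ (2⁻¹ : ℝ≥0∞) ^ i

/-- Martin-Löf randomness (with respect to Lebesgue measure). -/
def MLRandom (X : Cantor) : Prop :=
  ∀ W, IsMLTest W → X ∉ ⋂ i, openOf (W i)

/-- `X` is weakly deep: it is not tt-reducible to any Martin-Löf random sequence. -/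
def WeaklyDeep (X : Cantor) : Prop :=
  ¬ ∃ Y, MLRandom Y ∧ TTReducible X Y

/-! ### Continuous semimeasures -/

structure IsContinuousSemimeasure (P : List Bool → ℝ) : Prop where
  nonneg : ∀ σ, 0 ≤ P σ
  root_le_one : P [] ≤ 1
  split : ∀ σ, P (σ ++ [false]) + P (σ ++ [true]) ≤ P σ

/-- The nonnegative rational number coded by a pair of natural numbers. -/
noncomputable def ratVal (a : ℕ × ℕ) : ℝ := (a.1 : ℝ) / ((a.2 : ℝ) + 1)

/-- The values of `f` (which are nonnegative) are computable reals, uniformly in the string. -/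
def IsComputable (f : List Bool → ℝ) : Prop :=
  ∃ a : List Bool × ℕ → ℕ × ℕ, Computable a ∧
    ∀ σ k, |f σ - ratVal (a (σ, k))| ≤ (1 / 2 : ℝ) ^ k

/-- The values of `f` (which are nonnegative) are limits of computable nondecreasing sequences of
rationals, uniformly in the string. -/
def IsLowerSemicomputable (f : List Bool → ℝ) : Prop :=
  ∃ a : List Bool × ℕ → ℕ × ℕ, Computable a ∧
    ∀ σ, Monotone (fun s => ratVal (a (σ, s))) ∧
      Tendsto (fun s => ratVal (a (σ, s))) atTop (𝓝 (f σ))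

/-- A universal (lower semicomputable) continuous semimeasure. -/
structure IsUniversalSemimeasure (M : List Bool → ℝ) : Prop where
  semimeasure : IsContinuousSemimeasure M
  lowerSemicomputable : IsLowerSemicomputable M
  dominates : ∀ P, IsContinuousSemimeasure P → IsLowerSemicomputable P →
    ∃ c : ℝ, ∀ σ, P σ ≤ c * M σ

/-! ### Time-bounded a priori probability and `KA`-depth -/

/-- A Turing functional `U` (a monotone machine) is universal if every Turing functional is
simulated by `U` after reading a fixed string `ρ`: `U^(ρ Y) = Ψ^Y` for all `Y`. -/
def TuringFunctional.IsUniversal (U : TuringFunctional) : Prop :=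
  ∀ Ψ : TuringFunctional, ∃ ρ : List Bool, ∀ Y τ, U.Outputs (prepend ρ Y) τ ↔ Ψ.Outputs Y τ

/-- A time bound: a nondecreasing total function; here always required to be computable. -/
def IsComputableTimeBound (t : ℕ → ℕ) : Prop := Computable t ∧ Monotone t

/-- The time-bounded a priori probability `M^t(σ)`: the probability that `U`, on a random oracle,
outputs `σ` within the time bound, i.e. every prefix of `σ` of length `i` within `t i` steps. -/
noncomputable def TuringFunctional.timeBounded (U : TuringFunctional) (t : ℕ → ℕ)
    (σ : List Bool) : ℝ :=
  lebesgue.real {Y | ∀ i ≤ σ.length, U.OutputsBy (t i) Y (σ.take i)}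

/-- `-log₂ r`, with `-log₂ 0 = ∞`, for `r ≥ 0`. -/
noncomputable def negLog (r : ℝ) : EReal :=
  if r ≤ 0 then ⊤ else ((-Real.logb 2 r : ℝ) : EReal)

/-- A priori complexity `KA = -log₂ M`. -/
noncomputable def KA (M : List Bool → ℝ) (σ : List Bool) : EReal := negLog (M σ)

/-- Time-bounded a priori complexity `KA^t = -log₂ M^t`. -/
noncomputable def KAt (U : TuringFunctional) (t : ℕ → ℕ) (σ : List Bool) : EReal :=
  negLog (U.timeBounded t σ)

/-- `X` is `KA`-deep: `KA^t(X↾n) - KA(X↾n) → ∞` for every computable time bound `t`. -/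
def KADeep (M : List Bool → ℝ) (U : TuringFunctional) (X : Cantor) : Prop :=
  ∀ t, IsComputableTimeBound t →
    Tendsto (fun n => KAt U t (prefixOf X n) - KA M (prefixOf X n)) atTop (𝓝 ⊤)

end Depth

/-!
The proof goes round the cycle: ratio condition for all computable semimeasures ⟹ `KA`-deep ⟹
weakly deep ⟹ ratio condition.

* *Ratio condition ⟹ `KA`-deep.* For a computable time bound `t`, whether `σ` is output in time
  depends on a computable number of oracle bits only, so `M^t` is an exactly computable (dyadic)
  semimeasure and the ratio condition applies to it (`isContinuousSemimeasure_timeBounded`,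
  `isComputable_timeBounded`).

* *`KA`-deep ⟹ weakly deep.* Suppose `X = Φ^Y` with `Φ` total and `Y` random, and let `U` simulate
  `Φ` after reading `ρ₀`. By compactness the use and the running time of `U` on the extensions of
  `ρ₀` are bounded by a computable function `t`, so that `Φ` is given by a truth-table map `G`
  (`exists_ttMap`), and `M^t` is at least `2^{-|ρ₀|}` times the image `μ_G` of Lebesgue measure
  under `G`. By Kolmogorov's inequality for the supermartingale `M / μ_G` (`maximal_inequality`),
  the oracles on whose image `M / μ_G` exceeds `2ⁱ` form the `i`-th component of a Martin-Löf test.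
  As `Y` is random, `M / μ_G` is bounded along `X`, hence so is `M / M^t`.

* *Weakly deep ⟹ ratio condition.* A computable semimeasure `P` is dominated by an integer-valued
  allocation of cells of length `2n + 3` to the strings of length `n`, hence by `8 μ_G` for a
  truth-table map `G` (`IsContinuousSemimeasure.exists_ttMap_le`). If `X` is weakly deep, then no
  oracle that `G` maps to `X` is random. All of them lie in every component of the deficiency test
  `{Y : ∃ n, M(Y↾n) > 2^{i-n}}`, which is universal, and by compactness each component
  contains the full preimage of some prefix of `X`. For a test `W`, the weighted image
  `∑ᵢ 2^{i-1} λ(G⁻¹[σ] ∩ W₂ᵢ)` is a lower semicomputable semimeasure, so it is at most a constant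
  times `M`. Therefore `M / μ_G` tends to infinity along `X`
  (`IsUniversalSemimeasure.eventually_mul_lt`). The same lemma for the identity map gives the
  universality of the deficiency test.
-/

namespace Depth

/-! ### Strings and prefixes -/

@[simp]
theorem length_prefixOf (X : Cantor) (n : ℕ) : (prefixOf X n).length = n := by
  simp [prefixOf]

theorem getElem?_prefixOf (X : Cantor) {n i : ℕ} (h : i < n) : (prefixOf X n)[i]? = some (X i) := by
  simp [prefixOf, h]

theorem prefixOf_eq_iff {X Y : Cantor} {n : ℕ} :
    prefixOf X n = prefixOf Y n ↔ ∀ i < n, X i = Y i := by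
  simp [prefixOf, List.map_inj_left]

theorem prefixOf_succ (X : Cantor) (n : ℕ) : prefixOf X (n + 1) = prefixOf X n ++ [X n] := by
  simp [prefixOf, List.range_succ]

theorem take_prefixOf (X : Cantor) {m n : ℕ} (h : m ≤ n) :
    (prefixOf X n).take m = prefixOf X m := by
  simp [prefixOf, ← List.map_take, List.take_range, h]

theorem prefixOf_isPrefix (X : Cantor) {m n : ℕ} (h : m ≤ n) : prefixOf X m <+: prefixOf X n := by
  rw [← take_prefixOf X h]; exact List.take_prefix _ _

theorem isPrefix_prefixOf_iff {X : Cantor} {τ : List Bool} {n : ℕ} :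
    τ <+: prefixOf X n ↔ τ.length ≤ n ∧ prefixOf X τ.length = τ := by
  constructor
  · intro h
    have hl : τ.length ≤ n := by simpa using h.length_le
    exact ⟨hl, by rw [← take_prefixOf X hl]; exact (List.prefix_iff_eq_take.1 h).symm⟩
  · rintro ⟨hl, h⟩
    rw [← h]; exact prefixOf_isPrefix X (by simpa using hl)

theorem prefixOf_prepend (ρ : List Bool) (Y : Cantor) (n : ℕ) :
    prefixOf (prepend ρ Y) (ρ.length + n) = ρ ++ prefixOf Y n := by
  apply List.ext_getElem?
  intro i
  rcases lt_or_ge i (ρ.length + n) with h | h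
  · rw [getElem?_prefixOf _ h]
    rcases lt_or_ge i ρ.length with h' | h'
    · simp [prepend, h', List.getElem?_append_left]
    · rw [List.getElem?_append_right h', getElem?_prefixOf _ (by omega)]
      simp [prepend, h']
  · rw [List.getElem?_eq_none, List.getElem?_eq_none] <;> simp <;> omega

/-- The sequence `ρ 0 0 0 …`. -/
def padZeros (ρ : List Bool) : Cantor := fun i => ρ.getD i false

@[simp]
theorem prefixOf_padZeros (ρ : List Bool) : prefixOf (padZeros ρ) ρ.length = ρ := by
  apply List.ext_getElem?
  intro i
  rcases lt_or_ge i ρ.length with h | h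
  · rw [getElem?_prefixOf _ h]; simp [padZeros, h]
  · rw [List.getElem?_eq_none, List.getElem?_eq_none] <;> simp [h]

/-- The list of all strings of length `n`. -/
def strings : ℕ → List (List Bool)
  | 0 => [[]]
  | n + 1 => (strings n).flatMap fun ρ => [ρ ++ [false], ρ ++ [true]]

theorem mem_strings {n : ℕ} {ρ : List Bool} : ρ ∈ strings n ↔ ρ.length = n := by
  induction n generalizing ρ with
  | zero => simp [strings]
  | succ n ih =>
    simp only [strings, List.mem_flatMap, List.mem_cons, List.not_mem_nil, or_false]
    constructor
    · rintro ⟨σ, hσ, rfl | rfl⟩ <;> simp [ih.1 hσ]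
    · intro h
      rcases List.eq_nil_or_concat ρ with rfl | ⟨σ, b, rfl⟩
      · simp at h
      · refine ⟨σ, ih.2 (by simpa using h), ?_⟩
        cases b <;> simp

theorem prefixOf_mem_strings (X : Cantor) (n : ℕ) : prefixOf X n ∈ strings n :=
  mem_strings.2 (length_prefixOf X n)

theorem nodup_strings (n : ℕ) : (strings n).Nodup := by
  induction n with
  | zero => simp [strings]
  | succ n ih =>
    simp only [strings]
    rw [List.nodup_flatMap]
    refine ⟨fun ρ _ => by simp, ih.imp fun {a b} hab => ?_⟩
    simp only [Function.onFun, List.disjoint_left, List.mem_cons, List.not_mem_nil, or_false]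
    rintro x (rfl | rfl) (h | h) <;>
      exact hab (List.append_inj_left' h rfl)

/-! ### Topology and measure of sets determined by a prefix -/

theorem isOpen_setOf_prefixOf (p : List Bool → Prop) (n : ℕ) : IsOpen {Y | p (prefixOf Y n)} := by
  rw [isOpen_iff_forall_mem_open]
  intro Y hY
  refine ⟨PiNat.cylinder Y n, fun Z hZ => ?_, PiNat.isOpen_cylinder _ Y n,
    PiNat.self_mem_cylinder Y n⟩
  have : prefixOf Z n = prefixOf Y n := prefixOf_eq_iff.2 (PiNat.mem_cylinder_iff.1 hZ)
  simpa [this] using hY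

theorem isClosed_setOf_prefixOf (p : List Bool → Prop) (n : ℕ) :
    IsClosed {Y | p (prefixOf Y n)} :=
  ⟨isOpen_setOf_prefixOf (fun ρ => ¬ p ρ) n⟩

theorem measurableSet_setOf_prefixOf (p : List Bool → Prop) (n : ℕ) :
    MeasurableSet {Y | p (prefixOf Y n)} :=
  (isOpen_setOf_prefixOf p n).measurableSet

theorem isOpen_openOf (W : List Bool → Prop) : IsOpen (openOf W) := by
  have : openOf W = ⋃ n, {Y | W (prefixOf Y n)} := by ext; simp [openOf]
  rw [this]
  exact isOpen_iUnion fun n => isOpen_setOf_prefixOf W n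

instance : IsProbabilityMeasure lebesgue := by
  unfold lebesgue; infer_instance

theorem lebesgue_setOf_prefixOf_eq {n : ℕ} {ρ : List Bool} (h : ρ.length = n) :
    lebesgue {Y | prefixOf Y n = ρ} = (2⁻¹ : ℝ≥0∞) ^ n := by
  have : {Y | prefixOf Y n = ρ} =
      Set.pi (Finset.range n : Set ℕ) fun i => {padZeros ρ i} := by
    ext Y
    have hρ := prefixOf_padZeros ρ
    rw [h] at hρ
    have : prefixOf Y n = ρ ↔ ∀ i < n, Y i = padZeros ρ i := by
      rw [← prefixOf_eq_iff, hρ]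
    simp [this]
  rw [this, lebesgue, Measure.infinitePi_pi _ (fun i _ => MeasurableSet.singleton _)]
  simp

theorem lebesgue_setOf_prefixOf (p : List Bool → Bool) (n : ℕ) :
    lebesgue {Y | p (prefixOf Y n)} = (strings n).countP p * (2⁻¹ : ℝ≥0∞) ^ n := by
  have key : ∀ l : List (List Bool), l.Nodup → (∀ ρ ∈ l, ρ.length = n) →
      lebesgue {Y | prefixOf Y n ∈ l} = l.length * (2⁻¹ : ℝ≥0∞) ^ n := by
    intro l
    induction l with
    | nil => simp
    | cons ρ l ih =>
      intro hl hlen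
      rw [List.nodup_cons] at hl
      have hu : {Y | prefixOf Y n ∈ ρ :: l} =
          {Y | prefixOf Y n = ρ} ∪ {Y | prefixOf Y n ∈ l} := by ext; simp
      rw [hu, measure_union _ (measurableSet_setOf_prefixOf (· ∈ l) n),
        ih hl.2 fun σ hσ => hlen σ (by simp [hσ]), lebesgue_setOf_prefixOf_eq (hlen ρ (by simp))]
      · push_cast [List.length_cons]; ring
      · rw [Set.disjoint_left]
        intro Y h1 h2
        simp only [Set.mem_ofPred_eq] at h1 h2
        exact hl.1 (h1 ▸ h2)
  rw [List.countP_eq_length_filter, ← key _ ((nodup_strings n).filter p)]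
  · congr 1; ext Y; simp [prefixOf_mem_strings]
  · intro ρ hρ; exact mem_strings.1 (List.mem_of_mem_filter hρ)

theorem lebesgue_real_setOf_prefixOf (p : List Bool → Bool) (n : ℕ) :
    lebesgue.real {Y | p (prefixOf Y n)} = (strings n).countP p / 2 ^ n := by
  rw [measureReal_def, lebesgue_setOf_prefixOf]
  simp [div_eq_mul_inv]

/-! ### Truth-table maps -/

/-- A total Turing functional in truth-table form: the first `n` bits of the output are read off
from the first `use n` bits of the oracle by means of a computable table. -/
structure TTMap where
  /-- The use function. -/
  use : ℕ → ℕ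
  /-- The table: output of length `n`, given the first `use n` bits of the oracle. -/
  table : ℕ → List Bool → List Bool
  /-- The map on sequences. -/
  toFun : Cantor → Cantor
  use_computable : Computable use
  table_computable : Computable₂ table
  prefixOf_toFun : ∀ Y n, prefixOf (toFun Y) n = table n (prefixOf Y (use n))

namespace TTMap

/-- The identity. -/
def id : TTMap where
  use n := n
  table _ ρ := ρ
  toFun Y := Y
  use_computable := Computable.id
  table_computable := Computable.snd
  prefixOf_toFun _ _ := rfl

/-- The set of oracles that are mapped to extensions of `σ`. -/
def preimage (G : TTMap) (σ : List Bool) : Set Cantor :=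
  {Y | prefixOf (G.toFun Y) σ.length = σ}

/-- The number of rows of the table that produce `σ`. -/
def count (G : TTMap) (σ : List Bool) : ℕ :=
  (strings (G.use σ.length)).countP fun ρ => decide (G.table σ.length ρ = σ)

variable (G : TTMap)

theorem preimage_eq (σ : List Bool) :
    G.preimage σ = {Y | G.table σ.length (prefixOf Y (G.use σ.length)) = σ} := by
  simp [preimage, G.prefixOf_toFun]

theorem isClosed_preimage (σ : List Bool) : IsClosed (G.preimage σ) := by
  rw [preimage_eq]; exact isClosed_setOf_prefixOf (fun ρ => G.table σ.length ρ = σ) _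

theorem measurableSet_preimage (σ : List Bool) : MeasurableSet (G.preimage σ) :=
  (G.isClosed_preimage σ).measurableSet

theorem lebesgue_real_preimage (σ : List Bool) :
    lebesgue.real (G.preimage σ) = G.count σ / 2 ^ G.use σ.length := by
  rw [preimage_eq, count, ← lebesgue_real_setOf_prefixOf]; simp

theorem mem_preimage_prefixOf {Y : Cantor} {X : Cantor} {n : ℕ} :
    Y ∈ G.preimage (prefixOf X n) ↔ prefixOf (G.toFun Y) n = prefixOf X n := by
  simp [preimage]

theorem preimage_nil : G.preimage [] = Set.univ := by
  ext; simp [preimage, prefixOf]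

theorem mem_preimage_append {σ : List Bool} {b : Bool} {Y : Cantor} :
    Y ∈ G.preimage (σ ++ [b]) ↔ Y ∈ G.preimage σ ∧ G.toFun Y σ.length = b := by
  simp only [preimage, Set.mem_ofPred_eq, List.length_append, List.length_singleton,
    prefixOf_succ]
  constructor
  · intro h
    have := List.append_inj h (by simp)
    simpa using this
  · rintro ⟨h1, h2⟩
    rw [h1, h2]

theorem preimage_append_union (σ : List Bool) :
    G.preimage (σ ++ [false]) ∪ G.preimage (σ ++ [true]) = G.preimage σ := by
  ext Y
  cases h : G.toFun Y σ.length <;> simp [mem_preimage_append, h]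

theorem disjoint_preimage_append (σ : List Bool) :
    Disjoint (G.preimage (σ ++ [false])) (G.preimage (σ ++ [true])) := by
  rw [Set.disjoint_left]
  intro Y h1 h2
  rw [mem_preimage_append] at h1 h2
  simp [h1.2] at h2

end TTMap

/-! ### Computability of bounded counting, sums and quantifiers -/

section Computability

variable {α β : Type*} [Primcodable α] [Primcodable β]

theorem computable_list_countP {p : α → β → Bool} {l : α → List β} (hp : Computable₂ p)
    (hl : Computable l) : Computable fun a => (l a).countP (p a) := by
  have h : Computable fun a => Nat.rec (motive := fun _ => ℕ) 0
      (fun i c => c + (((l a)[i]?).map fun b => (p a b).toNat).getD 0) (l a).length := by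
    refine Computable.nat_rec (f := fun a => (l a).length) (g := fun _ => 0)
      (h := fun a q => q.2 + (((l a)[q.1]?).map fun b => (p a b).toNat).getD 0)
      (Computable.list_length.comp hl) (Computable.const 0) ?_
    refine Primrec.nat_add.to_comp.comp (Computable.snd.comp Computable.snd) ?_
    refine Computable.option_getD (Computable.option_map
      (Computable.list_getElem?.comp (hl.comp Computable.fst)
        (Computable.fst.comp Computable.snd)) ?_) (Computable.const 0)
    exact (Primrec.dom_bool Bool.toNat).to_comp.comp
      (hp.comp (Computable.fst.comp Computable.fst) Computable.snd)
  refine h.of_eq fun a => ?_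
  have key : ∀ k ≤ (l a).length, Nat.rec (motive := fun _ => ℕ) 0
      (fun i c => c + (((l a)[i]?).map fun b => (p a b).toNat).getD 0) k =
      ((l a).take k).countP (p a) := by
    intro k hk
    induction k with
    | zero => simp
    | succ k ih =>
      have hk' : k < (l a).length := hk
      rw [List.take_succ_eq_append_getElem hk', List.countP_append, ← ih (by omega)]
      cases hb : p a (l a)[k] <;> simp [hk', hb]
  simpa using key _ le_rfl

theorem computable_list_all {p : α → β → Bool} {l : α → List β} (hp : Computable₂ p)
    (hl : Computable l) : Computable fun a => (l a).all (p a) := by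
  refine (Primrec.eq.decide.to_comp.comp (computable_list_countP hp hl)
    (Computable.list_length.comp hl)).of_eq fun a => ?_
  rw [Bool.eq_iff_iff]; simp [List.countP_eq_length]

theorem computable_list_any {p : α → β → Bool} {l : α → List β} (hp : Computable₂ p)
    (hl : Computable l) : Computable fun a => (l a).any (p a) := by
  refine (Primrec.nat_lt.decide.to_comp.comp (Computable.const 0)
    (computable_list_countP hp hl)).of_eq fun a => ?_
  rw [Bool.eq_iff_iff]; simp [List.countP_pos_iff]

theorem computable_range_all {p : α → ℕ → Bool} {n : α → ℕ} (hp : Computable₂ p)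
    (hn : Computable n) : Computable fun a => (List.range (n a)).all (p a) :=
  computable_list_all hp (Primrec.list_range.to_comp.comp hn)

theorem computable_range_any {p : α → ℕ → Bool} {n : α → ℕ} (hp : Computable₂ p)
    (hn : Computable n) : Computable fun a => (List.range (n a)).any (p a) :=
  computable_list_any hp (Primrec.list_range.to_comp.comp hn)

theorem computable_sum_range {f : α → ℕ → ℕ} {n : α → ℕ} (hf : Computable₂ f)
    (hn : Computable n) : Computable fun a => ∑ i ∈ Finset.range (n a), f a i := by
  have h : Computable fun a => Nat.rec (motive := fun _ => ℕ) 0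
      (fun i c => c + f a i) (n a) := by
    refine Computable.nat_rec (f := n) (g := fun _ => 0)
      (h := fun a q => q.2 + f a q.1) hn (Computable.const 0) ?_
    exact Primrec.nat_add.to_comp.comp (Computable.snd.comp Computable.snd)
      (hf.comp Computable.fst (Computable.fst.comp Computable.snd))
  refine h.of_eq fun a => ?_
  induction n a with
  | zero => simp
  | succ k ih => rw [Finset.sum_range_succ, ← ih]

theorem computable_two_pow : Computable fun n : ℕ => 2 ^ n := by
  have h : Computable fun n : ℕ => Nat.rec (motive := fun _ => ℕ) 1 (fun _ c => c * 2) n := by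
    refine Computable.nat_rec (f := fun n : ℕ => n) (g := fun _ => 1)
      (h := fun _ q => q.2 * 2) Computable.id (Computable.const 1) ?_
    exact Primrec.nat_mul.to_comp.comp (Computable.snd.comp Computable.snd) (Computable.const 2)
  refine h.of_eq fun n => ?_
  induction n with
  | zero => simp
  | succ k ih => rw [pow_succ, ← ih]

theorem computable_strings : Computable strings := by
  have h : Primrec fun n : ℕ => Nat.rec (motive := fun _ => List (List Bool)) [[]]
      (fun _ l => l.flatMap fun ρ => [ρ ++ [false], ρ ++ [true]]) n := by
    refine Primrec.nat_rec₁ _ (Primrec.list_flatMap Primrec.snd ?_)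
    exact Primrec.list_cons.comp (Primrec.list_concat.comp Primrec.snd (Primrec.const false))
      (Primrec.list_cons.comp (Primrec.list_concat.comp Primrec.snd (Primrec.const true))
        (Primrec.const []))
  refine h.to_comp.of_eq fun n => ?_
  induction n with
  | zero => rfl
  | succ k ih => simp only [strings, ← ih]

theorem computable_isPrefixOf :
    Computable₂ fun σ τ : List Bool => decide (σ <+: τ) := by
  refine (Primrec.eq.decide.to_comp.comp (Computable.fst (α := List Bool) (β := List Bool))
    (Primrec.list_take.to_comp.comp (Computable.list_length.comp Computable.fst)
      Computable.snd)).of_eq fun a => ?_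
  simp [List.prefix_iff_eq_take]

theorem computable_and {p q : α → Bool} (hp : Computable p) (hq : Computable q) :
    Computable fun a => p a && q a :=
  Primrec.and.to_comp.comp hp hq

theorem computable_or {p q : α → Bool} (hp : Computable p) (hq : Computable q) :
    Computable fun a => p a || q a :=
  Primrec.or.to_comp.comp hp hq

/-- A recursively enumerable predicate is the projection of a decidable one. -/
theorem exists_computable_of_rePred {p : α → Prop} (hp : REPred p) :
    ∃ f : α → ℕ → Bool, Computable₂ f ∧ ∀ a, p a ↔ ∃ s, f a s := by
  obtain ⟨c, hc⟩ := Nat.Partrec.Code.exists_code.1 hp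
  refine ⟨fun a s => (Nat.Partrec.Code.evaln s c (Encodable.encode a)).isSome, ?_, fun a => ?_⟩
  · refine Primrec.to_comp (Primrec.option_isSome.comp (Nat.Partrec.Code.primrec_evaln.comp
      (Primrec.pair (Primrec.pair Primrec.snd (Primrec.const c))
        (Primrec.encode.comp Primrec.fst))))
  · have h1 := congrFun hc (Encodable.encode a)
    simp only [Encodable.encodek, Part.coe_some, Part.bind_some] at h1
    have h2 : p a ↔ (Nat.Partrec.Code.eval c (Encodable.encode a)).Dom := by
      rw [h1]; simp [Part.assert]
    rw [h2, Part.dom_iff_mem]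
    simp only [Nat.Partrec.Code.evaln_complete, Option.isSome_iff_exists]
    exact exists_comm

/-- The projection of a decidable predicate is recursively enumerable. -/
theorem rePred_exists {f : α → ℕ → Bool} (hf : Computable₂ f) : REPred fun a => ∃ s, f a s := by
  have h : Partrec fun a => Nat.rfind fun s => Part.some (f a s) :=
    Partrec.rfind (p := fun a s => Part.some (f a s)) hf.partrec₂
  refine h.dom_re.of_eq fun a => ?_
  refine Nat.rfind_dom'.trans ?_
  simp

theorem computable_nat_find {p : α → ℕ → Bool} (hp : Computable₂ p) (h : ∀ a, ∃ s, p a s) :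
    Computable fun a => Nat.find (h a) := by
  have h' : Partrec fun a => Nat.rfind fun s => Part.some (p a s) :=
    Partrec.rfind (p := fun a s => Part.some (p a s)) hp.partrec₂
  refine h'.of_eq_tot fun a => Nat.mem_rfind.2 ⟨?_, fun {m} hm => ?_⟩
  · simpa using (Nat.find_spec (h a)).symm
  · simpa using (Nat.find_min (h a) hm)

end Computability

theorem TTMap.computable_count (G : TTMap) : Computable G.count := by
  refine computable_list_countP (p := fun σ ρ => decide (G.table σ.length ρ = σ))
    (l := fun σ => strings (G.use σ.length)) ?_
    (computable_strings.comp (G.use_computable.comp Computable.list_length))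
  exact Primrec.eq.decide.to_comp.comp
    (G.table_computable.comp (Computable.list_length.comp Computable.fst) Computable.snd)
    Computable.fst

/-! ### The maximal inequality and the deficiency test -/

/-- Kolmogorov's maximal inequality for the image of Lebesgue measure under a truth-table map:
the oracles whose image has, at some length between `|τ|` and `|τ| + N`, a prefix on which the
semimeasure `M` exceeds the image measure by the factor `2 ^ i` have measure at most
`2⁻ⁱ M(τ)` inside the preimage of `τ`. -/
theorem maximal_inequality {M : List Bool → ℝ} (hM : IsContinuousSemimeasure M) (G : TTMap)
    (i N : ℕ) (τ : List Bool) :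
    2 ^ i * lebesgue.real {Y | Y ∈ G.preimage τ ∧ ∃ n, τ.length ≤ n ∧ n ≤ τ.length + N ∧
      2 ^ i * lebesgue.real (G.preimage (prefixOf (G.toFun Y) n)) < M (prefixOf (G.toFun Y) n)} ≤
      M τ := by
  induction N generalizing τ with
  | zero =>
    by_cases hτ : 2 ^ i * lebesgue.real (G.preimage τ) < M τ
    · refine le_trans ?_ hτ.le
      exact mul_le_mul_of_nonneg_left (measureReal_mono fun Y hY => hY.1) (by positivity)
    · have : {Y | Y ∈ G.preimage τ ∧ ∃ n, τ.length ≤ n ∧ n ≤ τ.length + 0 ∧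
          2 ^ i * lebesgue.real (G.preimage (prefixOf (G.toFun Y) n)) <
            M (prefixOf (G.toFun Y) n)} = ∅ := by
        rw [Set.eq_empty_iff_forall_notMem]
        rintro Y ⟨hY, n, h1, h2, h3⟩
        obtain rfl : n = τ.length := by omega
        rw [show prefixOf (G.toFun Y) τ.length = τ from hY] at h3
        exact hτ h3
      rw [this]
      simpa using hM.nonneg τ
  | succ N ih =>
    by_cases hτ : 2 ^ i * lebesgue.real (G.preimage τ) < M τ
    · refine le_trans ?_ hτ.le
      exact mul_le_mul_of_nonneg_left (measureReal_mono fun Y hY => hY.1) (by positivity)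
    · refine le_trans ?_ ((add_le_add (ih (τ ++ [false])) (ih (τ ++ [true]))).trans (hM.split τ))
      rw [← mul_add]
      gcongr
      refine (measureReal_mono ?_).trans (measureReal_union_le _ _)
      rintro Y ⟨hY, n, h1, h2, h3⟩
      have hn : n ≠ τ.length := by
        rintro rfl
        rw [show prefixOf (G.toFun Y) τ.length = τ from hY] at h3
        exact hτ h3
      rw [← G.preimage_append_union] at hY
      refine hY.imp (fun h => ⟨h, n, ?_, ?_, h3⟩) fun h => ⟨h, n, ?_, ?_, h3⟩ <;> simp <;> omega

/-- The strings that witness that the image under `G` has randomness deficiency more than `i`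
with respect to the image measure. -/
def deficiencyTest (M : List Bool → ℝ) (G : TTMap) (i : ℕ) (ρ : List Bool) : Prop :=
  ∃ n, G.use n = ρ.length ∧
    2 ^ i * lebesgue.real (G.preimage (G.table n ρ)) < M (G.table n ρ)

theorem mem_openOf_deficiencyTest {M : List Bool → ℝ} {G : TTMap} {i : ℕ} {Y : Cantor} :
    Y ∈ openOf (deficiencyTest M G i) ↔
      ∃ n, 2 ^ i * lebesgue.real (G.preimage (prefixOf (G.toFun Y) n)) <
        M (prefixOf (G.toFun Y) n) := by
  constructor
  · rintro ⟨_, n, h, hn⟩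
    rw [length_prefixOf] at h
    exact ⟨n, by rwa [G.prefixOf_toFun, h]⟩
  · rintro ⟨n, hn⟩
    exact ⟨G.use n, n, by simp, by rwa [← G.prefixOf_toFun]⟩

theorem IsLowerSemicomputable.lt_iff {f : List Bool → ℝ} {a : List Bool × ℕ → ℕ × ℕ}
    {σ : List Bool} (hm : Monotone fun s => ratVal (a (σ, s)))
    (ht : Tendsto (fun s => ratVal (a (σ, s))) atTop (𝓝 (f σ))) {x : ℝ} :
    x < f σ ↔ ∃ s, x < ratVal (a (σ, s)) :=
  ⟨fun h => (ht.eventually_const_lt h).exists,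
    fun ⟨s, hs⟩ => hs.trans_le (hm.ge_of_tendsto ht s)⟩

theorem isMLTest_deficiencyTest {M : List Bool → ℝ} (hM : IsContinuousSemimeasure M)
    (hM' : IsLowerSemicomputable M) (G : TTMap) : IsMLTest (deficiencyTest M G) := by
  constructor
  · obtain ⟨a, ha, hlim⟩ := hM'
    have key : ∀ (i : ℕ) (τ : List Bool), 2 ^ i * lebesgue.real (G.preimage τ) < M τ ↔
        ∃ s, 2 ^ i * G.count τ * ((a (τ, s)).2 + 1) < (a (τ, s)).1 * 2 ^ G.use τ.length := by
      intro i τ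
      rw [IsLowerSemicomputable.lt_iff (hlim τ).1 (hlim τ).2]
      refine exists_congr fun s => ?_
      rw [G.lebesgue_real_preimage, ratVal, ← mul_div_assoc,
        div_lt_div_iff₀ (by positivity) (by positivity)]
      exact_mod_cast Iff.rfl
    let f : ℕ × List Bool → ℕ → Bool := fun p k =>
      let n := k.unpair.1
      let τ := G.table n p.2
      let q := a (τ, k.unpair.2)
      decide (G.use n = p.2.length) &&
        decide (2 ^ p.1 * G.count τ * (q.2 + 1) < q.1 * 2 ^ G.use τ.length)
    have hf : Computable₂ f := by
      have hn : Computable fun x : (ℕ × List Bool) × ℕ => x.2.unpair.1 :=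
        Computable.fst.comp (Computable.unpair.comp Computable.snd)
      have hs : Computable fun x : (ℕ × List Bool) × ℕ => x.2.unpair.2 :=
        Computable.snd.comp (Computable.unpair.comp Computable.snd)
      have hρ : Computable fun x : (ℕ × List Bool) × ℕ => x.1.2 :=
        Computable.snd.comp Computable.fst
      have hτ : Computable fun x : (ℕ × List Bool) × ℕ => G.table x.2.unpair.1 x.1.2 :=
        G.table_computable.comp hn hρ
      have hq := ha.comp (hτ.pair hs)
      refine computable_and (Primrec.eq.decide.to_comp.comp (G.use_computable.comp hn)
        (Computable.list_length.comp hρ)) (Primrec.nat_lt.decide.to_comp.comp ?_ ?_)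
      · exact Primrec.nat_mul.to_comp.comp (Primrec.nat_mul.to_comp.comp
          (computable_two_pow.comp (Computable.fst.comp Computable.fst))
          (G.computable_count.comp hτ)) (Computable.succ.comp (Computable.snd.comp hq))
      · exact Primrec.nat_mul.to_comp.comp (Computable.fst.comp hq)
          (computable_two_pow.comp (G.use_computable.comp (Computable.list_length.comp hτ)))
    refine (rePred_exists hf).of_eq fun p => ?_
    simp only [f, deficiencyTest, key, Bool.and_eq_true, decide_eq_true_eq]
    constructor
    · rintro ⟨k, h1, h2⟩
      exact ⟨_, h1, _, h2⟩
    · rintro ⟨n, h1, s, h2⟩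
      exact ⟨Nat.pair n s, by simpa using h1, by simpa using h2⟩
  · intro i
    let S : ℕ → Set Cantor := fun N => {Y | Y ∈ G.preimage [] ∧ ∃ n, ([] : List Bool).length ≤ n ∧
      n ≤ ([] : List Bool).length + N ∧
      2 ^ i * lebesgue.real (G.preimage (prefixOf (G.toFun Y) n)) < M (prefixOf (G.toFun Y) n)}
    have hS : openOf (deficiencyTest M G i) = ⋃ N, S N := by
      ext Y
      rw [mem_openOf_deficiencyTest]
      simp only [S, G.preimage_nil, Set.mem_iUnion]
      constructor
      · rintro ⟨n, hn⟩
        exact ⟨n, trivial, n, by simp, by simp, hn⟩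
      · rintro ⟨N, -, n, -, -, hn⟩
        exact ⟨n, hn⟩
    have hmono : Monotone S := by
      rintro a b hab Y ⟨h1, n, h2, h3, h4⟩
      exact ⟨h1, n, h2, by omega, h4⟩
    rw [hS, hmono.measure_iUnion]
    refine iSup_le fun N => ?_
    have h := (maximal_inequality hM G i N []).trans hM.root_le_one
    rw [← ofReal_measureReal (measure_ne_top _ _)]
    have h' : lebesgue.real (S N) ≤ (2⁻¹ : ℝ) ^ i := by
      rw [inv_pow, ← one_div, le_div_iff₀ (by positivity), mul_comm]
      exact h
    refine (ENNReal.ofReal_le_ofReal h').trans ?_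
    rw [ENNReal.ofReal_pow (by positivity), ENNReal.ofReal_inv_of_pos two_pos]
    simp

/-- The image of a random sequence under a truth-table map has bounded deficiency with respect to
the image measure. -/
theorem MLRandom.exists_le_preimage {M : List Bool → ℝ} (hM : IsContinuousSemimeasure M)
    (hM' : IsLowerSemicomputable M) (G : TTMap) {Y : Cantor} (hY : MLRandom Y) :
    ∃ i : ℕ, ∀ n, M (prefixOf (G.toFun Y) n) ≤
      2 ^ i * lebesgue.real (G.preimage (prefixOf (G.toFun Y) n)) := by
  have := hY _ (isMLTest_deficiencyTest hM hM' G)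
  rw [Set.mem_iInter] at this
  push Not at this
  obtain ⟨i, hi⟩ := this
  rw [mem_openOf_deficiencyTest] at hi
  push Not at hi
  exact ⟨i, hi⟩

/-! ### The semimeasure of a Martin-Löf test -/

/-- Every uniformly c.e. sequence of open sets is generated by a decidable family of sets of
strings that are closed under extension. -/
theorem exists_computable_openOf_eq {W : ℕ → List Bool → Prop}
    (hW : REPred fun p : ℕ × List Bool => W p.1 p.2) :
    ∃ D : ℕ → List Bool → Bool, Computable₂ D ∧
      (∀ i ρ ρ', ρ <+: ρ' → D i ρ → D i ρ') ∧
      ∀ i Y, Y ∈ openOf (W i) ↔ ∃ n, D i (prefixOf Y n) := by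
  obtain ⟨f, hf, hWf⟩ := exists_computable_of_rePred hW
  have hWf' : ∀ i τ, W i τ ↔ ∃ s, f (i, τ) s := fun i τ => hWf (i, τ)
  -- A string is accepted once its length bounds a stage at which some prefix is enumerated.
  let D : ℕ → List Bool → Bool := fun i ρ => (List.range (ρ.length + 1)).any fun m =>
    (List.range (ρ.length + 1)).any fun s => f (i, ρ.take m) s
  have hD : ∀ i ρ, D i ρ ↔ ∃ τ s, τ <+: ρ ∧ s ≤ ρ.length ∧ f (i, τ) s := by
    intro i ρ
    simp only [D, List.any_eq_true, List.mem_range, Nat.lt_succ_iff]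
    constructor
    · rintro ⟨m, -, s, hs, h⟩
      exact ⟨_, s, List.take_prefix _ _, hs, h⟩
    · rintro ⟨τ, s, hτ, hs, h⟩
      exact ⟨τ.length, hτ.length_le, s, hs, by rwa [← List.prefix_iff_eq_take.1 hτ]⟩
  refine ⟨D, ?_, ?_, ?_⟩
  · have hl : Computable fun p : ℕ × List Bool => p.2.length + 1 :=
      Computable.succ.comp (Computable.list_length.comp Computable.snd)
    refine computable_range_any (p := fun (p : ℕ × List Bool) m =>
      (List.range (p.2.length + 1)).any fun s => f (p.1, p.2.take m) s) ?_ hl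
    refine computable_range_any (p := fun (x : (ℕ × List Bool) × ℕ) s =>
      f (x.1.1, x.1.2.take x.2) s) ?_ (hl.comp Computable.fst)
    refine hf.comp (Computable.pair ?_ ?_) Computable.snd
    · exact Computable.fst.comp (Computable.fst.comp Computable.fst)
    · exact Primrec.list_take.to_comp.comp (Computable.snd.comp Computable.fst)
        (Computable.snd.comp (Computable.fst.comp Computable.fst))
  · intro i ρ ρ' h hρ
    rw [hD] at hρ ⊢
    obtain ⟨τ, s, hτ, hs, hf⟩ := hρ
    exact ⟨τ, s, hτ.trans h, hs.trans h.length_le, hf⟩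
  · intro i Y
    constructor
    · rintro ⟨n, hn⟩
      obtain ⟨s, hs⟩ := (hWf' _ _).1 hn
      exact ⟨max n s, (hD _ _).2 ⟨_, s, prefixOf_isPrefix Y (le_max_left _ _), by simp, hs⟩⟩
    · rintro ⟨n, hn⟩
      obtain ⟨τ, s, hτ, -, hs⟩ := (hD _ _).1 hn
      refine ⟨τ.length, (hWf' _ _).2 ⟨s, ?_⟩⟩
      rwa [(isPrefix_prefixOf_iff.1 hτ).2]

theorem tendsto_sum_range_of_monotone {f : ℕ → ℕ → ℝ≥0∞} {a : ℕ → ℝ≥0∞}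
    (hf : ∀ i, Monotone (f i)) (h : ∀ i, Tendsto (f i) atTop (𝓝 (a i))) :
    Tendsto (fun s => ∑ i ∈ Finset.range s, f i s) atTop (𝓝 (∑' i, a i)) := by
  rw [tendsto_order]
  constructor
  · intro x hx
    obtain ⟨n, hn⟩ := (ENNReal.tendsto_nat_tsum a).eventually_const_lt hx |>.exists
    have h' : Tendsto (fun s => ∑ i ∈ Finset.range n, f i s) atTop
        (𝓝 (∑ i ∈ Finset.range n, a i)) := tendsto_finsetSum _ fun i _ => h i
    filter_upwards [h'.eventually_const_lt hn, eventually_ge_atTop n] with s hs hns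
    exact hs.trans_le (Finset.sum_le_sum_of_subset (Finset.range_subset_range.2 hns))
  · intro x hx
    refine Eventually.of_forall fun s => lt_of_le_of_lt ?_ hx
    exact (Finset.sum_le_sum fun i _ => (hf i).ge_of_tendsto (h i) s).trans
      (ENNReal.sum_le_tsum _)

/-- The weight of the `2i`-th component of a test. -/
noncomputable def testWeight (i : ℕ) : ℝ≥0∞ := 2 ^ i * 2⁻¹

/-- The semimeasure induced by a Martin-Löf test `W` and a truth-table map: the image of the measure
`∑ᵢ 2ⁱ⁻¹ λ(· ∩ W₂ᵢ)`. -/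
noncomputable def testSemimeasure (W : ℕ → List Bool → Prop) (G : TTMap) (σ : List Bool) : ℝ≥0∞ :=
  ∑' i, testWeight i * lebesgue (G.preimage σ ∩ openOf (W (2 * i)))

theorem testSemimeasure_nil_le {W : ℕ → List Bool → Prop} (hW : IsMLTest W) (G : TTMap) :
    testSemimeasure W G [] ≤ 1 := by
  have h : ∀ i, testWeight i * lebesgue (G.preimage [] ∩ openOf (W (2 * i))) ≤
      2⁻¹ * 2⁻¹ ^ i := by
    intro i
    calc testWeight i * lebesgue (G.preimage [] ∩ openOf (W (2 * i)))
        ≤ 2 ^ i * 2⁻¹ * 2⁻¹ ^ (2 * i) := by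
          unfold testWeight
          gcongr
          exact (measure_mono Set.inter_subset_right).trans (hW.2 _)
      _ = 2⁻¹ * 2⁻¹ ^ i * (2 * 2⁻¹) ^ i := by rw [mul_pow, two_mul, pow_add]; ring
      _ = 2⁻¹ * 2⁻¹ ^ i := by
          rw [ENNReal.mul_inv_cancel (by norm_num) (by norm_num)]; simp
  refine (ENNReal.tsum_le_tsum h).trans ?_
  rw [ENNReal.tsum_mul_left, ENNReal.tsum_geometric]
  simp [ENNReal.inv_mul_cancel]

theorem testSemimeasure_append (W : ℕ → List Bool → Prop) (G : TTMap) (σ : List Bool) :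
    testSemimeasure W G (σ ++ [false]) + testSemimeasure W G (σ ++ [true]) =
      testSemimeasure W G σ := by
  unfold testSemimeasure
  rw [← ENNReal.tsum_add]
  congr 1
  ext i
  rw [← mul_add, ← measure_union, ← Set.union_inter_distrib_right, G.preimage_append_union]
  · exact (G.disjoint_preimage_append σ).mono Set.inter_subset_left Set.inter_subset_left
  · exact (G.measurableSet_preimage _).inter (isOpen_openOf _).measurableSet

theorem testSemimeasure_ne_top {W : ℕ → List Bool → Prop} (hW : IsMLTest W) (G : TTMap)
    (σ : List Bool) : testSemimeasure W G σ ≠ ⊤ := by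
  refine ne_top_of_le_ne_top (b := testSemimeasure W G []) ?_ ?_
  · exact ne_top_of_le_ne_top ENNReal.one_ne_top (testSemimeasure_nil_le hW G)
  · unfold testSemimeasure
    gcongr
    rw [G.preimage_nil]
    exact Set.subset_univ _

theorem isContinuousSemimeasure_testSemimeasure {W : ℕ → List Bool → Prop} (hW : IsMLTest W)
    (G : TTMap) : IsContinuousSemimeasure fun σ => (testSemimeasure W G σ).toReal where
  nonneg _ := ENNReal.toReal_nonneg
  root_le_one := ENNReal.toReal_le_of_le_ofReal zero_le_one
    (by simpa using testSemimeasure_nil_le hW G)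
  split σ := by
    rw [← ENNReal.toReal_add (testSemimeasure_ne_top hW G _) (testSemimeasure_ne_top hW G _),
      testSemimeasure_append]

theorem isLowerSemicomputable_testSemimeasure {W : ℕ → List Bool → Prop} (hW : IsMLTest W)
    (G : TTMap) : IsLowerSemicomputable fun σ => (testSemimeasure W G σ).toReal := by
  obtain ⟨D, hD, hDmono, hDW⟩ := exists_computable_openOf_eq hW.1
  let B : List Bool → ℕ → ℕ → Set Cantor := fun σ i s =>
    G.preimage σ ∩ {Y | D (2 * i) (prefixOf Y (s + G.use σ.length))}
  have hBmono : ∀ σ i, Monotone (B σ i) := by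
    rintro σ i s s' hs Y ⟨h1, h2⟩
    exact ⟨h1, hDmono _ _ _ (prefixOf_isPrefix Y (by omega)) h2⟩
  have hBunion : ∀ σ i, ⋃ s, B σ i s = G.preimage σ ∩ openOf (W (2 * i)) := by
    intro σ i
    rw [← Set.inter_iUnion]
    congr 1
    ext Y
    simp only [Set.mem_iUnion, hDW]
    constructor
    · rintro ⟨s, hs⟩; exact ⟨_, hs⟩
    · rintro ⟨n, hn⟩
      exact ⟨n, hDmono _ _ _ (prefixOf_isPrefix Y (Nat.le_add_right _ _)) hn⟩
  let cnt : List Bool → ℕ → ℕ → ℕ := fun σ s i =>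
    (strings (s + G.use σ.length)).countP fun ρ =>
      decide (G.table σ.length (ρ.take (G.use σ.length)) = σ) && D (2 * i) ρ
  have hBcnt : ∀ σ i s, lebesgue (B σ i s) = cnt σ s i * (2⁻¹ : ℝ≥0∞) ^ (s + G.use σ.length) := by
    intro σ i s
    rw [← lebesgue_setOf_prefixOf]
    congr 1
    ext Y
    simp only [B, G.preimage_eq, Set.mem_inter_iff, Set.mem_ofPred_eq, Bool.and_eq_true,
      decide_eq_true_eq, take_prefixOf Y (Nat.le_add_left (G.use σ.length) s)]
  let q : List Bool → ℕ → ℝ≥0∞ := fun σ s => ∑ i ∈ Finset.range s, testWeight i * lebesgue (B σ i s)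
  have hwtop : ∀ i, testWeight i ≠ ⊤ := fun i => by unfold testWeight; finiteness
  have hqlim : ∀ σ, Tendsto (q σ) atTop (𝓝 (testSemimeasure W G σ)) := by
    intro σ
    refine tendsto_sum_range_of_monotone (fun i s s' hs => ?_) fun i => ?_
    · gcongr
      exact hBmono σ i hs
    · refine ENNReal.Tendsto.const_mul ?_ (Or.inr (hwtop i))
      rw [← hBunion]
      exact tendsto_measure_iUnion_atTop (hBmono σ i)
  have hqmono : ∀ σ, Monotone (q σ) := by
    intro σ s s' hs
    refine (Finset.sum_le_sum_of_subset (Finset.range_subset_range.2 hs)).trans ?_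
    refine Finset.sum_le_sum fun i _ => ?_
    gcongr
    exact hBmono σ i hs
  have hqtop : ∀ σ s, q σ s ≠ ⊤ := fun σ s =>
    ne_top_of_le_ne_top (testSemimeasure_ne_top hW G σ) ((hqmono σ).ge_of_tendsto (hqlim σ) s)
  let a : List Bool × ℕ → ℕ × ℕ := fun p =>
    (∑ i ∈ Finset.range p.2, 2 ^ i * cnt p.1 p.2 i, 2 ^ (p.2 + G.use p.1.length + 1) - 1)
  have haq : ∀ σ s, ratVal (a (σ, s)) = (q σ s).toReal := by
    intro σ s
    have h1 : (((2 ^ (s + G.use σ.length + 1) - 1 : ℕ) : ℝ) + 1) =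
        2 ^ (s + G.use σ.length) * 2 := by
      rw [Nat.cast_sub Nat.one_le_two_pow]; push_cast; ring
    simp only [ratVal, a, h1, q]
    rw [ENNReal.toReal_sum fun i _ => by have := hwtop i; finiteness, Nat.cast_sum,
      Finset.sum_div]
    refine Finset.sum_congr rfl fun i _ => ?_
    rw [hBcnt]
    simp only [testWeight, ENNReal.toReal_mul, ENNReal.toReal_pow, ENNReal.toReal_inv,
      ENNReal.toReal_natCast, ENNReal.toReal_ofNat, inv_pow]
    push_cast
    field_simp
  refine ⟨a, ?_, fun σ => ⟨?_, ?_⟩⟩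
  · have hL : Computable fun p : List Bool × ℕ => p.2 + G.use p.1.length :=
      Primrec.nat_add.to_comp.comp Computable.snd
        (G.use_computable.comp (Computable.list_length.comp Computable.fst))
    refine Computable.pair ?_ ?_
    · refine computable_sum_range (f := fun (p : List Bool × ℕ) i => 2 ^ i * cnt p.1 p.2 i) ?_
        Computable.snd
      refine Primrec.nat_mul.to_comp.comp (computable_two_pow.comp Computable.snd) ?_
      have hlen : Computable fun x : ((List Bool × ℕ) × ℕ) × List Bool => x.1.1.1.length :=
        Computable.list_length.comp (Computable.fst.comp (Computable.fst.comp Computable.fst))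
      refine computable_list_countP (p := fun (x : (List Bool × ℕ) × ℕ) ρ =>
        decide (G.table x.1.1.length (ρ.take (G.use x.1.1.length)) = x.1.1) && D (2 * x.2) ρ)
        (l := fun x => strings (x.1.2 + G.use x.1.1.length)) ?_
        (computable_strings.comp (hL.comp Computable.fst))
      refine computable_and (Primrec.eq.decide.to_comp.comp ?_ ?_) ?_
      · exact G.table_computable.comp hlen (Primrec.list_take.to_comp.comp
          (G.use_computable.comp hlen) Computable.snd)
      · exact Computable.fst.comp (Computable.fst.comp Computable.fst)
      · exact hD.comp (Primrec.nat_mul.to_comp.comp (Computable.const 2)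
          (Computable.snd.comp Computable.fst)) Computable.snd
    · exact Computable.pred.comp (computable_two_pow.comp (Computable.succ.comp hL))
  · intro s s' hs
    simp only [haq]
    exact ENNReal.toReal_mono (hqtop σ s') (hqmono σ hs)
  · simp only [haq]
    exact (ENNReal.tendsto_toReal (testSemimeasure_ne_top hW G σ)).comp (hqlim σ)

/-- If every oracle that `G` maps to an extension of `σ` lies in the `2i`-th component of a test,
then a universal semimeasure exceeds the image measure of `σ` by a factor of order `2 ^ i`. -/
theorem IsUniversalSemimeasure.exists_preimage_le {M : List Bool → ℝ}
    (hM : IsUniversalSemimeasure M) {W : ℕ → List Bool → Prop} (hW : IsMLTest W) (G : TTMap) :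
    ∃ C : ℝ, ∀ i σ, G.preimage σ ⊆ openOf (W (2 * i)) →
      2 ^ i * lebesgue.real (G.preimage σ) ≤ C * M σ := by
  obtain ⟨c, hc⟩ := hM.dominates _ (isContinuousSemimeasure_testSemimeasure hW G)
    (isLowerSemicomputable_testSemimeasure hW G)
  refine ⟨2 * c, fun i σ h => ?_⟩
  have h1 : testWeight i * lebesgue (G.preimage σ) ≤ testSemimeasure W G σ := by
    conv_lhs => rw [← Set.inter_eq_left.2 h]
    exact ENNReal.le_tsum (f := fun i => testWeight i *
      lebesgue (G.preimage σ ∩ openOf (W (2 * i)))) i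
  have h2 := (ENNReal.toReal_mono (testSemimeasure_ne_top hW G σ) h1).trans (hc σ)
  simp only [testWeight, ENNReal.toReal_mul, ENNReal.toReal_pow, ENNReal.toReal_inv,
    ENNReal.toReal_ofNat] at h2
  rw [measureReal_def]
  linarith

theorem IsUniversalSemimeasure.pos {M : List Bool → ℝ} (hM : IsUniversalSemimeasure M)
    (σ : List Bool) : 0 < M σ := by
  have hW : IsMLTest fun i _ => i = 0 := by
    constructor
    · exact (rePred_exists (f := fun (p : ℕ × List Bool) _ => decide (p.1 = 0))
        (Primrec.eq.decide.to_comp.comp (Computable.fst.comp Computable.fst)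
          (Computable.const 0))).of_eq fun p => by simp
    · intro i
      rcases eq_or_ne i 0 with rfl | hi
      · simpa using prob_le_one
      · simp [openOf, hi]
  obtain ⟨C, hC⟩ := hM.exists_preimage_le hW TTMap.id
  have h := hC 0 σ fun Y _ => ⟨0, rfl⟩
  have hpos : 0 < lebesgue.real (TTMap.id.preimage σ) := by
    have : TTMap.id.preimage σ = {Y | prefixOf Y σ.length = σ} := rfl
    rw [this, measureReal_def, lebesgue_setOf_prefixOf_eq rfl]
    simp
  refine (hM.semimeasure.nonneg σ).lt_of_ne fun h0 => ?_
  rw [← h0] at h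
  linarith

/-! ### Total Turing functionals in truth-table form -/

namespace TuringFunctional

variable (U : TuringFunctional)

variable {U} in
theorem OutputsBy.of_isPrefix {s : ℕ} {Y : Cantor} {τ τ' : List Bool} (h : U.OutputsBy s Y τ')
    (hτ : τ <+: τ') : U.OutputsBy s Y τ := by
  rcases h with rfl | ⟨k, hk, n, τ'', he, h⟩
  · exact Or.inl (List.prefix_nil.1 hτ)
  · exact Or.inr ⟨k, hk, n, τ'', he, hτ.trans h⟩

variable {U} in
theorem Outputs.comparable {Y : Cantor} {τ τ' : List Bool} (h : U.Outputs Y τ)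
    (h' : U.Outputs Y τ') : τ <+: τ' ∨ τ' <+: τ := by
  obtain ⟨s, rfl | ⟨k, -, n, υ, he, h⟩⟩ := h
  · exact Or.inl (List.nil_prefix)
  obtain ⟨s', rfl | ⟨k', -, n', υ', he', h'⟩⟩ := h'
  · exact Or.inr (List.nil_prefix)
  have hυ : υ <+: υ' ∨ υ' <+: υ := by
    rcases le_total n n' with hn | hn
    · exact U.consistent k k' _ _ _ _ he he' (prefixOf_isPrefix Y hn)
    · exact (U.consistent k' k _ _ _ _ he' he (prefixOf_isPrefix Y hn)).symm
  rcases hυ with hυ | hυ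
  · exact List.prefix_or_prefix_of_prefix (h.trans hυ) h'
  · exact List.prefix_or_prefix_of_prefix h (h'.trans hυ)

variable {U} in
theorem Computes.prefixOf_length_eq {Y X : Cantor} (hX : U.Computes Y X) {τ : List Bool}
    (h : U.Outputs Y τ) : prefixOf X τ.length = τ := by
  rcases h.comparable (hX τ.length) with h | h
  · exact (h.eq_of_length (by simp)).symm
  · exact h.eq_of_length (by simp)

theorem computable_enum_getD {α σ : Type*} [Primcodable α] [Primcodable σ] {k : α → ℕ}
    {f : α → List Bool × List Bool → σ} (d : σ) (hk : Computable k) (hf : Computable₂ f) :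
    Computable fun a => ((U.enum (k a)).map (f a)).getD d :=
  Computable.option_getD (Computable.option_map (U.computable.comp hk) hf) (Computable.const d)

/-- The `k`-th enumerated pair applies to oracles extending `ρ` and has an output of length at
least `n`. -/
def hits (n k : ℕ) (ρ : List Bool) : Bool :=
  ((U.enum k).map fun x => decide (x.1 <+: ρ) && decide (n ≤ x.2.length)).getD false

theorem hits_iff {n k : ℕ} {ρ : List Bool} :
    U.hits n k ρ ↔ ∃ α τ, U.enum k = some (α, τ) ∧ α <+: ρ ∧ n ≤ τ.length := by
  unfold hits
  rcases U.enum k with _ | ⟨α, τ⟩ <;> simp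

theorem computable_hits {α : Type*} [Primcodable α] {n k : α → ℕ} {ρ : α → List Bool}
    (hn : Computable n) (hk : Computable k) (hρ : Computable ρ) :
    Computable fun a => U.hits (n a) (k a) (ρ a) := by
  refine U.computable_enum_getD (f := fun a x => decide (x.1 <+: ρ a) &&
    decide (n a ≤ x.2.length)) false hk (computable_and ?_ ?_)
  · exact computable_isPrefixOf.comp (Computable.fst.comp Computable.snd)
      (hρ.comp Computable.fst)
  · exact Primrec.nat_le.decide.to_comp.comp (hn.comp Computable.fst)
      (Computable.list_length.comp (Computable.snd.comp Computable.snd))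

/-- On every oracle that extends `ρ₀` by `s` bits, `U` outputs at least `n` bits within `s`
steps. -/
def allHit (ρ₀ : List Bool) (n s : ℕ) : Bool :=
  (strings s).all fun ρ => (List.range s).any fun k => U.hits n k (ρ₀ ++ ρ)

theorem allHit_iff {ρ₀ : List Bool} {n s : ℕ} :
    U.allHit ρ₀ n s ↔ ∀ Z, ∃ k < s, U.hits n k (ρ₀ ++ prefixOf Z s) := by
  simp only [allHit, List.all_eq_true, List.any_eq_true, List.mem_range]
  constructor
  · exact fun h Z => h _ (prefixOf_mem_strings Z s)
  · intro h ρ hρ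
    have := h (padZeros ρ)
    rw [← mem_strings.1 hρ] at this ⊢
    rwa [prefixOf_padZeros] at this

theorem computable_allHit (ρ₀ : List Bool) : Computable₂ (U.allHit ρ₀) := by
  refine computable_list_all (p := fun (x : ℕ × ℕ) ρ =>
    (List.range x.2).any fun k => U.hits x.1 k (ρ₀ ++ ρ)) ?_
    (computable_strings.comp Computable.snd)
  refine computable_range_any (p := fun (x : (ℕ × ℕ) × List Bool) k =>
    U.hits x.1.1 k (ρ₀ ++ x.2)) ?_ (Computable.snd.comp Computable.fst)
  exact U.computable_hits (Computable.fst.comp (Computable.fst.comp Computable.fst)) Computable.snd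
    (Computable.list_append.comp (Computable.const ρ₀) (Computable.snd.comp Computable.fst))

/-- Compactness of Cantor space bounds the use and the running time of a functional that is total
on all extensions of `ρ₀`. -/
theorem exists_allHit {ρ₀ : List Bool} (hU : ∀ Z, ∃ X, U.Computes (prepend ρ₀ Z) X) (n : ℕ) :
    ∃ s, U.allHit ρ₀ n s := by
  let O : ℕ → Set Cantor := fun s => {Z | ∃ k < s, U.hits n k (ρ₀ ++ prefixOf Z s)}
  have hO : ∀ s, IsOpen (O s) := fun s =>
    isOpen_setOf_prefixOf (fun ρ => ∃ k < s, U.hits n k (ρ₀ ++ ρ)) s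
  have hmono : Monotone O := by
    rintro s s' hs Z ⟨k, hk, h⟩
    refine ⟨k, hk.trans_le hs, ?_⟩
    rw [hits_iff] at h ⊢
    obtain ⟨α, τ, he, hα, hn⟩ := h
    exact ⟨α, τ, he, hα.trans
      ((List.prefix_append_right_inj _).2 (prefixOf_isPrefix Z hs)), hn⟩
  have hcover : (Set.univ : Set Cantor) ⊆ ⋃ s, O s := by
    intro Z _
    obtain ⟨X, hX⟩ := hU Z
    -- Length `n + 1` excludes the empty output, which is not enumerated.
    obtain ⟨s, h | ⟨k, -, m, τ, he, hτ⟩⟩ := hX (n + 1)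
    · simp [prefixOf] at h
    · refine Set.mem_iUnion.2 ⟨max (k + 1) m, k, by simp, ?_⟩
      rw [hits_iff]
      refine ⟨_, _, he, ?_, ?_⟩
      · rw [← prefixOf_prepend]
        exact prefixOf_isPrefix _ (by have := le_max_right (k + 1) m; omega)
      · have := hτ.length_le
        rw [length_prefixOf] at this
        omega
  obtain ⟨s, hs⟩ := isCompact_univ.elim_directed_cover O hO hcover hmono.directed_le
  exact ⟨s, U.allHit_iff.2 fun Z => hs (Set.mem_univ Z)⟩

/-- The output of length `n` read off from the last pair enumerated within `s` steps that applies
to `ρ`. -/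
def readOff (n : ℕ) (ρ : List Bool) (s : ℕ) : List Bool :=
  Nat.rec (motive := fun _ => List Bool) []
    (fun k υ => bif U.hits n k ρ then
      ((U.enum k).map fun x => x.2.take n).getD [] else υ) s

theorem computable_readOff {α : Type*} [Primcodable α] {n s : α → ℕ} {ρ : α → List Bool}
    (hn : Computable n) (hρ : Computable ρ) (hs : Computable s) :
    Computable fun a => U.readOff (n a) (ρ a) (s a) := by
  refine Computable.nat_rec (f := s) (g := fun _ => ([] : List Bool))
    (h := fun a q => bif U.hits (n a) q.1 (ρ a) then
      ((U.enum q.1).map fun x => x.2.take (n a)).getD [] else q.2) hs (Computable.const []) ?_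
  have hk : Computable fun x : α × ℕ × List Bool => x.2.1 := Computable.fst.comp Computable.snd
  refine Computable.cond
    (U.computable_hits (hn.comp Computable.fst) hk (hρ.comp Computable.fst)) ?_
    (Computable.snd.comp Computable.snd)
  exact U.computable_enum_getD (f := fun (a : α × ℕ × List Bool) x => x.2.take (n a.1)) [] hk
    (Primrec.list_take.to_comp.comp (hn.comp (Computable.fst.comp Computable.fst))
      (Computable.snd.comp Computable.snd))

theorem readOff_eq {n s m : ℕ} {Y X : Cantor} (hX : U.Computes Y X)
    (h : ∃ k < s, U.hits n k (prefixOf Y m)) : U.readOff n (prefixOf Y m) s = prefixOf X n := by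
  induction s with
  | zero => simp at h
  | succ s ih =>
    change (bif U.hits n s (prefixOf Y m) then
      ((U.enum s).map fun x => x.2.take n).getD [] else U.readOff n (prefixOf Y m) s) = _
    cases hs : U.hits n s (prefixOf Y m) with
    | true =>
      obtain ⟨α, τ, he, hα, hn⟩ := U.hits_iff.1 hs
      have ho : U.Outputs Y τ := ⟨s + 1, Or.inr ⟨s, by omega, α.length, τ,
        by rw [he, (isPrefix_prefixOf_iff.1 hα).2], List.prefix_rfl⟩⟩
      have := hX.prefixOf_length_eq ho
      simp only [he, cond_true, Option.map_some, Option.getD_some]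
      rw [← this, take_prefixOf X hn]
    | false =>
      obtain ⟨k, hk, h⟩ := h
      refine ih ⟨k, ?_, h⟩
      rcases Nat.lt_succ_iff_lt_or_eq.1 hk with hk | rfl
      · exact hk
      · rw [hs] at h; cases h

/-- A functional that is total on all extensions of `ρ₀` is, above `ρ₀`, given by a truth-table
map whose use is also a bound on the running time. -/
theorem exists_ttMap {ρ₀ : List Bool} (hU : ∀ Z, ∃ X, U.Computes (prepend ρ₀ Z) X) :
    ∃ G : TTMap, Monotone G.use ∧ (∀ Z, U.Computes (prepend ρ₀ Z) (G.toFun Z)) ∧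
      ∀ Z n, U.OutputsBy (G.use n) (prepend ρ₀ Z) (prefixOf (G.toFun Z) n) := by
  have hex := U.exists_allHit hU
  choose F hF using hU
  let use : ℕ → ℕ := fun n => Nat.find (hex n)
  have huse : ∀ n Z, ∃ k < use n, U.hits n k (ρ₀ ++ prefixOf Z (use n)) := fun n =>
    U.allHit_iff.1 (Nat.find_spec (hex n))
  have hcomp : Computable use := computable_nat_find (U.computable_allHit ρ₀) hex
  let G : TTMap :=
    { use := use
      table := fun n ρ => U.readOff n (ρ₀ ++ ρ) (use n)
      toFun := F
      use_computable := hcomp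
      table_computable := U.computable_readOff Computable.fst
        (Computable.list_append.comp (Computable.const ρ₀) Computable.snd)
        (hcomp.comp Computable.fst)
      prefixOf_toFun := fun Z n => by
        have h := huse n Z
        rw [← prefixOf_prepend] at h ⊢
        exact (U.readOff_eq (hF Z) h).symm }
  refine ⟨G, fun m n hmn => ?_, hF, fun Z n => ?_⟩
  · refine Nat.find_mono fun s hs => ?_
    rw [allHit_iff] at hs ⊢
    intro Z
    obtain ⟨k, hk, h⟩ := hs Z
    rw [hits_iff] at h
    obtain ⟨α, τ, he, hα, hn⟩ := h
    exact ⟨k, hk, U.hits_iff.2 ⟨α, τ, he, hα, hmn.trans hn⟩⟩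
  · obtain ⟨k, hk, h⟩ := huse n Z
    obtain ⟨α, τ, he, hα, hn⟩ := U.hits_iff.1 h
    rw [← prefixOf_prepend] at hα
    have he' : U.enum k = some (prefixOf (prepend ρ₀ Z) α.length, τ) := by
      rw [he, (isPrefix_prefixOf_iff.1 hα).2]
    have hτ : U.OutputsBy (use n) (prepend ρ₀ Z) τ :=
      Or.inr ⟨k, hk, _, τ, he', List.prefix_rfl⟩
    refine hτ.of_isPrefix ?_
    rw [← (hF Z).prefixOf_length_eq ⟨_, hτ⟩]
    exact prefixOf_isPrefix _ hn

end TuringFunctional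

/-- Prepending a string `ρ₀` to the oracle costs a factor of `2 ^ |ρ₀|` in measure. -/
theorem lebesgue_real_le_of_prepend {ρ₀ : List Bool} {E : Set Cantor} {m : ℕ}
    {p : List Bool → Bool} (h : ∀ Z, p (prefixOf Z m) → prepend ρ₀ Z ∈ E) :
    lebesgue.real {Z | p (prefixOf Z m)} ≤ 2 ^ ρ₀.length * lebesgue.real E := by
  let p' : List Bool → Bool := fun ρ => decide (ρ₀ <+: ρ) && p (ρ.drop ρ₀.length)
  have hsub : {Y | p' (prefixOf Y (ρ₀.length + m))} ⊆ E := by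
    intro Y hY
    simp only [p', Set.mem_ofPred_eq, Bool.and_eq_true, decide_eq_true_eq] at hY
    have hpre := (isPrefix_prefixOf_iff.1 hY.1).2
    have hY' : Y = prepend ρ₀ fun i => Y (ρ₀.length + i) := by
      funext i
      unfold prepend
      rcases lt_or_ge i ρ₀.length with hi | hi
      · rw [← hpre, length_prefixOf, getElem?_prefixOf _ hi, Option.getD_some]
      · simp [hi]
    rw [hY'] at hY ⊢
    rw [prefixOf_prepend, List.drop_left] at hY
    exact h _ hY.2
  have hcount : (strings m).countP p ≤ (strings (ρ₀.length + m)).countP p' := by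
    rw [List.countP_eq_length_filter, List.countP_eq_length_filter,
      ← List.length_map (f := fun ρ => ρ₀ ++ ρ)]
    refine (List.subperm_of_subset (((nodup_strings m).filter p).map
      (List.append_right_injective ρ₀)) ?_).length_le
    intro ρ hρ
    simp only [List.mem_map, List.mem_filter, mem_strings] at hρ ⊢
    obtain ⟨υ, ⟨h1, h2⟩, rfl⟩ := hρ
    exact ⟨by simp [h1], by simp [p', h2]⟩
  refine le_trans ?_ (mul_le_mul_of_nonneg_left (measureReal_mono hsub) (by positivity))
  rw [lebesgue_real_setOf_prefixOf, lebesgue_real_setOf_prefixOf, pow_add, mul_div_assoc',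
    mul_div_mul_left _ _ (by positivity)]
  gcongr

/-! ### Reformulation of the limit conditions -/

theorem tendsto_ofReal_div_nhds_top_iff {m p : ℕ → ℝ} (hm : ∀ n, 0 < m n) (hp : ∀ n, 0 ≤ p n) :
    Tendsto (fun n => ENNReal.ofReal (m n) / ENNReal.ofReal (p n)) atTop (𝓝 ⊤) ↔
      ∀ C : ℝ, ∀ᶠ n in atTop, C * p n < m n := by
  rw [ENNReal.tendsto_nhds_top_iff_nnreal]
  have key : ∀ (x : NNReal) n,
      (x : ℝ≥0∞) < ENNReal.ofReal (m n) / ENNReal.ofReal (p n) ↔ x * p n < m n := by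
    intro x n
    rw [ENNReal.lt_div_iff_mul_lt (Or.inr ENNReal.coe_ne_top) (Or.inl ENNReal.ofReal_ne_top),
      ← ENNReal.ofReal_coe_nnreal, ← ENNReal.ofReal_mul x.coe_nonneg,
      ENNReal.ofReal_lt_ofReal_iff (hm n)]
  simp only [key]
  refine ⟨fun h C => (h C.toNNReal).mono fun n hn => lt_of_le_of_lt ?_ hn, fun h x => h x⟩
  exact mul_le_mul_of_nonneg_right (Real.le_coe_toNNReal C) (hp n)

theorem tendsto_negLog_sub_nhds_top_iff {m p : ℕ → ℝ} (hm : ∀ n, 0 < m n) (hp : ∀ n, 0 ≤ p n) :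
    Tendsto (fun n => negLog (p n) - negLog (m n)) atTop (𝓝 ⊤) ↔
      ∀ C : ℝ, ∀ᶠ n in atTop, C * p n < m n := by
  rw [EReal.tendsto_nhds_top_iff_real]
  have key : ∀ (x : ℝ) n, (x : EReal) < negLog (p n) - negLog (m n) ↔ 2 ^ x * p n < m n := by
    intro x n
    unfold negLog
    rw [if_neg (hm n).not_ge]
    rcases (hp n).eq_or_lt with h0 | h0
    · rw [← h0, if_pos le_rfl, EReal.top_sub_coe]
      simpa using hm n
    · rw [if_neg h0.not_ge, ← EReal.coe_sub, EReal.coe_lt_coe_iff,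
        ← Real.logb_lt_logb_iff one_lt_two (by positivity) (hm n),
        Real.logb_mul (by positivity) h0.ne', Real.logb_rpow two_pos (by norm_num)]
      constructor <;> intro h <;> linarith
  simp only [key]
  refine ⟨fun h C => ?_, fun h x => h _⟩
  rcases le_or_gt C 0 with hC | hC
  · exact Eventually.of_forall fun n =>
      (mul_nonpos_of_nonpos_of_nonneg hC (hp n)).trans_lt (hm n)
  · simpa [Real.rpow_logb two_pos (by norm_num) hC] using h (Real.logb 2 C)

/-! ### The time-bounded a priori probability -/

namespace TuringFunctional

variable (U : TuringFunctional)

/-- The `k`-th enumerated pair applies to oracles extending `ρ` and has an output that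
extends `τ`. -/
def yields (k : ℕ) (ρ τ : List Bool) : Bool :=
  ((U.enum k).map fun x => decide (x.1 <+: ρ) && decide (τ <+: x.2)).getD false

/-- Decision procedure for `U.OutputsBy s Y τ`, given a sufficiently long prefix `ρ` of `Y`. -/
def outputsWithin (s : ℕ) (ρ τ : List Bool) : Bool :=
  decide (τ.length = 0) || (List.range s).any fun k => U.yields k ρ τ

/-- A bound on the lengths of the inputs that are enumerated within `s` steps. -/
def inputBound (s : ℕ) : ℕ :=
  ∑ k ∈ Finset.range s, ((U.enum k).map fun x => x.1.length).getD 0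

theorem length_le_inputBound {k s : ℕ} (hk : k < s) {α τ : List Bool}
    (h : U.enum k = some (α, τ)) : α.length ≤ U.inputBound s := by
  have := Finset.single_le_sum (f := fun k => ((U.enum k).map fun x => x.1.length).getD 0)
    (fun _ _ => Nat.zero_le _) (Finset.mem_range.2 hk)
  rw [h] at this
  exact this

theorem inputBound_mono : Monotone U.inputBound := fun _ _ h =>
  Finset.sum_le_sum_of_subset (Finset.range_subset_range.2 h)

theorem outputsWithin_iff {s n : ℕ} (hn : U.inputBound s ≤ n) {Y : Cantor} {τ : List Bool} :
    U.outputsWithin s (prefixOf Y n) τ ↔ U.OutputsBy s Y τ := by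
  simp only [outputsWithin, yields, OutputsBy, Bool.or_eq_true, decide_eq_true_eq,
    List.length_eq_zero_iff, List.any_eq_true, List.mem_range]
  refine or_congr_right (exists_congr fun k => and_congr_right fun hk => ?_)
  rcases he : U.enum k with _ | ⟨α, υ⟩
  · simp
  · simp only [Option.map_some, Option.getD_some, Bool.and_eq_true, decide_eq_true_eq,
      isPrefix_prefixOf_iff, Option.some.injEq, Prod.mk.injEq]
    constructor
    · rintro ⟨⟨-, h⟩, hτ⟩
      exact ⟨_, _, ⟨h.symm, rfl⟩, hτ⟩
    · rintro ⟨m, τ', ⟨rfl, rfl⟩, hτ⟩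
      exact ⟨⟨(U.length_le_inputBound hk he).trans hn, by simp⟩, hτ⟩

theorem computable_inputBound : Computable U.inputBound := by
  refine computable_sum_range (f := fun _ k => ((U.enum k).map fun x => x.1.length).getD 0)
    (n := fun s : ℕ => s) ?_ Computable.id
  exact U.computable_enum_getD (k := fun a : ℕ × ℕ => a.2) (f := fun _ x => x.1.length) 0
    Computable.snd (Computable.list_length.comp (Computable.fst.comp Computable.snd))

theorem computable_yields {α : Type*} [Primcodable α] {k : α → ℕ} {ρ τ : α → List Bool}
    (hk : Computable k) (hρ : Computable ρ) (hτ : Computable τ) :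
    Computable fun a => U.yields (k a) (ρ a) (τ a) := by
  have h1 : Computable₂ fun a (x : List Bool × List Bool) => decide (x.1 <+: ρ a) :=
    computable_isPrefixOf.comp (Computable.fst.comp Computable.snd) (hρ.comp Computable.fst)
  have h2 : Computable₂ fun a (x : List Bool × List Bool) => decide (τ a <+: x.2) :=
    computable_isPrefixOf.comp (hτ.comp Computable.fst) (Computable.snd.comp Computable.snd)
  exact U.computable_enum_getD false hk (computable_and h1 h2)

theorem computable_outputsWithin {α : Type*} [Primcodable α] {s : α → ℕ} {ρ τ : α → List Bool}
    (hs : Computable s) (hρ : Computable ρ) (hτ : Computable τ) :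
    Computable fun a => U.outputsWithin (s a) (ρ a) (τ a) := by
  have h1 : Computable fun a => decide ((τ a).length = 0) :=
    Primrec.eq.decide.to_comp.comp (Computable.list_length.comp hτ) (Computable.const 0)
  have h2 : Computable₂ fun a k => U.yields k (ρ a) (τ a) :=
    U.computable_yields Computable.snd (hρ.comp Computable.fst) (hτ.comp Computable.fst)
  exact computable_or h1 (computable_range_any h2 hs)

/-- Decision procedure for the event that `σ` is output within the time bound `t`. -/
def inTime (t : ℕ → ℕ) (σ ρ : List Bool) : Bool :=
  (List.range (σ.length + 1)).all fun i => U.outputsWithin (t i) ρ (σ.take i)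

theorem setOf_inTime {t : ℕ → ℕ} (ht : Monotone t) (σ : List Bool) :
    {Y | ∀ i ≤ σ.length, U.OutputsBy (t i) Y (σ.take i)} =
      {Y | U.inTime t σ (prefixOf Y (U.inputBound (t σ.length)))} := by
  ext Y
  simp only [inTime, Set.mem_ofPred_eq, List.all_eq_true, List.mem_range, Nat.lt_succ_iff]
  exact forall₂_congr fun i hi => (U.outputsWithin_iff (U.inputBound_mono (ht hi))).symm

theorem timeBounded_eq {t : ℕ → ℕ} (ht : Monotone t) (σ : List Bool) :
    U.timeBounded t σ = (strings (U.inputBound (t σ.length))).countP (U.inTime t σ) /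
      2 ^ U.inputBound (t σ.length) := by
  rw [timeBounded, U.setOf_inTime ht, lebesgue_real_setOf_prefixOf]

theorem isContinuousSemimeasure_timeBounded {t : ℕ → ℕ} (ht : Monotone t) :
    IsContinuousSemimeasure (U.timeBounded t) where
  nonneg _ := measureReal_nonneg
  root_le_one := measureReal_le_one
  split σ := by
    unfold timeBounded
    rw [← measureReal_union]
    · refine measureReal_mono ?_
      rintro Y (h | h) i hi <;>
      · have := h i (by simp; omega)
        rwa [List.take_append_of_le_length hi] at this
    · rw [Set.disjoint_left]
      intro Y h h'
      have h1 : U.Outputs Y (σ ++ [false]) := ⟨_, by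
        have := h _ le_rfl
        rwa [List.take_length] at this⟩
      have h2 : U.Outputs Y (σ ++ [true]) := ⟨_, by
        have := h' _ le_rfl
        rwa [List.take_length] at this⟩
      rcases h1.comparable h2 with h | h <;> simpa using h.eq_of_length (by simp)
    · rw [U.setOf_inTime ht]
      exact measurableSet_setOf_prefixOf (fun ρ => U.inTime t _ ρ) _

theorem isComputable_timeBounded {t : ℕ → ℕ} (ht : IsComputableTimeBound t) :
    IsComputable (U.timeBounded t) := by
  refine ⟨fun p => ((strings (U.inputBound (t p.1.length))).countP (U.inTime t p.1),
    2 ^ U.inputBound (t p.1.length) - 1), ?_, fun σ k => ?_⟩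
  · have hL : Computable fun p : List Bool × ℕ => U.inputBound (t p.1.length) :=
      U.computable_inputBound.comp (ht.1.comp (Computable.list_length.comp Computable.fst))
    refine Computable.pair ?_ (Computable.pred.comp (computable_two_pow.comp hL))
    refine computable_list_countP (p := fun (p : List Bool × ℕ) ρ => U.inTime t p.1 ρ) ?_
      (computable_strings.comp hL)
    refine computable_range_all (p := fun (x : (List Bool × ℕ) × List Bool) i =>
      U.outputsWithin (t i) x.2 (x.1.1.take i)) ?_ ?_
    · exact U.computable_outputsWithin (ht.1.comp Computable.snd)
        (Computable.snd.comp Computable.fst)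
        (Primrec.list_take.to_comp.comp Computable.snd
          (Computable.fst.comp (Computable.fst.comp Computable.fst)))
    · exact Computable.succ.comp (Computable.list_length.comp
        (Computable.fst.comp Computable.fst))
  · have h1 : (((2 ^ U.inputBound (t σ.length) - 1 : ℕ) : ℝ) + 1) =
        2 ^ U.inputBound (t σ.length) := by
      rw [Nat.cast_sub Nat.one_le_two_pow]; push_cast; ring
    rw [U.timeBounded_eq ht.2, ratVal, h1, sub_self, abs_zero]
    positivity

end TuringFunctional

/-! ### `KA`-depth and weak depth -/

theorem kaDeep_iff {M : List Bool → ℝ} (hM : IsUniversalSemimeasure M) {U : TuringFunctional}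
    {X : Cantor} : KADeep M U X ↔ ∀ t, IsComputableTimeBound t →
      ∀ C : ℝ, ∀ᶠ n in atTop, C * U.timeBounded t (prefixOf X n) < M (prefixOf X n) :=
  forall₂_congr fun t _ => tendsto_negLog_sub_nhds_top_iff
    (m := fun n => M (prefixOf X n)) (p := fun n => U.timeBounded t (prefixOf X n))
    (fun _ => hM.pos _) fun _ => measureReal_nonneg

/-- If `X` is the image of a random sequence under a total functional, simulated by `U`, then the
running time of the simulation is a time bound which refutes that `X` is `KA`-deep. -/
theorem KADeep.weaklyDeep {M : List Bool → ℝ} (hM : IsUniversalSemimeasure M)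
    {U : TuringFunctional} (hU : U.IsUniversal) {X : Cantor} (hX : KADeep M U X) :
    WeaklyDeep X := by
  rintro ⟨Y, hY, Φ, hΦ, hΦX⟩
  obtain ⟨ρ₀, hρ₀⟩ := hU Φ
  have hcomp : ∀ Z X, U.Computes (prepend ρ₀ Z) X ↔ Φ.Computes Z X := fun Z X =>
    forall_congr' fun n => hρ₀ Z _
  obtain ⟨G, hmono, hG, htime⟩ := U.exists_ttMap (ρ₀ := ρ₀) fun Z =>
    (hΦ Z).imp fun X => (hcomp Z X).2
  have hGX : ∀ n, prefixOf (G.toFun Y) n = prefixOf X n := fun n => by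
    have := ((hcomp Y X).2 hΦX).prefixOf_length_eq (hG Y n)
    rw [length_prefixOf] at this
    exact this.symm
  have hbound : ∀ σ, lebesgue.real (G.preimage σ) ≤
      2 ^ ρ₀.length * U.timeBounded G.use σ := by
    intro σ
    have := lebesgue_real_le_of_prepend (ρ₀ := ρ₀) (m := G.use σ.length)
      (p := fun ρ => decide (G.table σ.length ρ = σ))
      (E := {Y | ∀ i ≤ σ.length, U.OutputsBy (G.use i) Y (σ.take i)}) ?_
    · simpa [G.preimage_eq, TuringFunctional.timeBounded] using this
    · intro Z hZ i hi
      rw [decide_eq_true_eq, ← G.prefixOf_toFun] at hZ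
      rw [← hZ, take_prefixOf _ hi]
      exact htime Z i
  obtain ⟨i, hi⟩ := hY.exists_le_preimage hM.semimeasure hM.lowerSemicomputable G
  obtain ⟨n, hn⟩ := ((kaDeep_iff hM).1 hX G.use ⟨G.use_computable, hmono⟩
    (2 ^ i * 2 ^ ρ₀.length)).exists
  have h := hi n
  rw [hGX] at h
  refine (h.trans ?_).not_gt hn
  rw [mul_assoc]
  exact mul_le_mul_of_nonneg_left (hbound _) (by positivity)

/-! ### Truth-table maps as Turing functionals -/

/-- The Turing functional that enumerates the rows of the truth table. -/
def TTMap.toTuringFunctional (G : TTMap) : TuringFunctional where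
  enum k := (Encodable.decode (α := List Bool × ℕ) k).bind fun x =>
    bif decide (G.use x.2 = x.1.length) then some (x.1, G.table x.2 x.1) else none
  computable := by
    have hρ : Computable fun y : ℕ × List Bool × ℕ => y.2.1 :=
      Computable.fst.comp Computable.snd
    have hn : Computable fun y : ℕ × List Bool × ℕ => y.2.2 :=
      Computable.snd.comp Computable.snd
    refine Computable.option_bind (β := List Bool × ℕ) Computable.decode ?_
    refine Computable.cond ?_ ?_ (Computable.const none)
    · exact Primrec.eq.decide.to_comp.comp (G.use_computable.comp hn)
        (Computable.list_length.comp hρ)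
    · exact Computable.option_some.comp (hρ.pair (G.table_computable.comp hn hρ))
  consistent := by
    intro j k σ τ σ' τ' hj hk hσ
    have key : ∀ k σ τ, ((Encodable.decode (α := List Bool × ℕ) k).bind fun x =>
        bif decide (G.use x.2 = x.1.length) then some (x.1, G.table x.2 x.1) else none) =
          some (σ, τ) → ∃ n, G.use n = σ.length ∧ G.table n σ = τ := by
      intro k σ τ h
      obtain ⟨⟨ρ, n⟩, -, h⟩ := Option.bind_eq_some_iff.1 h
      by_cases hn : G.use n = ρ.length
      · simp only [hn, decide_true, cond_true, Option.some.injEq, Prod.mk.injEq] at h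
        obtain ⟨rfl, rfl⟩ := h
        exact ⟨n, hn, rfl⟩
      · simp [hn] at h
    obtain ⟨n, hn, rfl⟩ := key j σ τ hj
    obtain ⟨n', hn', rfl⟩ := key k σ' τ' hk
    have h' : prefixOf (padZeros σ') (G.use n') = σ' := by rw [hn', prefixOf_padZeros]
    have h : prefixOf (padZeros σ') (G.use n) = σ := by
      rw [hn]
      exact (isPrefix_prefixOf_iff.1 (h' ▸ hσ)).2
    have ho' : G.table n' σ' = prefixOf (G.toFun (padZeros σ')) n' := by
      rw [G.prefixOf_toFun, h']
    have ho : G.table n σ = prefixOf (G.toFun (padZeros σ')) n := by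
      rw [G.prefixOf_toFun, h]
    rw [ho, ho']
    rcases le_total n n' with h | h
    · exact Or.inl (prefixOf_isPrefix _ h)
    · exact Or.inr (prefixOf_isPrefix _ h)

theorem TTMap.computes_toTuringFunctional (G : TTMap) (Y : Cantor) :
    G.toTuringFunctional.Computes Y (G.toFun Y) := by
  intro n
  refine ⟨Encodable.encode (prefixOf Y (G.use n), n) + 1, Or.inr ⟨_, Nat.lt_succ_self _,
    G.use n, G.table n (prefixOf Y (G.use n)), ?_, ?_⟩⟩
  · simp [toTuringFunctional]
  · rw [G.prefixOf_toFun]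

theorem TTMap.ttReducible (G : TTMap) (Y : Cantor) : TTReducible (G.toFun Y) Y :=
  ⟨G.toTuringFunctional, fun Z => ⟨_, G.computes_toTuringFunctional Z⟩,
    G.computes_toTuringFunctional Y⟩

/-! ### Inducing a measure that dominates a computable semimeasure -/

/-- A computable semimeasure `P` is dominated by an integer-valued one at the scale `4^{-|σ|}`:
the added slack exceeds the rounding errors at the next level. -/
theorem exists_nat_majorant {P : List Bool → ℝ} (hP : IsContinuousSemimeasure P)
    (hP' : IsComputable P) :
    ∃ q : List Bool → ℕ, Computable q ∧ q [] ≤ 8 ∧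
      (∀ σ, q (σ ++ [false]) + q (σ ++ [true]) ≤ 4 * q σ) ∧ ∀ σ, 4 ^ σ.length * P σ ≤ q σ := by
  obtain ⟨a, ha, haP⟩ := hP'
  -- Precision `2 |σ| + 3` becomes an error of `1 / 8` after scaling by `4 ^ |σ|`; rounding down
  -- costs less than `1`, and the summand `5` provides the slack.
  let q : List Bool → ℕ := fun σ =>
    (a (σ, 2 * σ.length + 3)).1 * 2 ^ (2 * σ.length) / ((a (σ, 2 * σ.length + 3)).2 + 1) + 5
  have hq : ∀ σ, 4 ^ σ.length * P σ + 3.75 ≤ q σ ∧ (q σ : ℝ) ≤ 4 ^ σ.length * P σ + 5.25 := by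
    intro σ
    have h := haP σ (2 * σ.length + 3)
    set x := a (σ, 2 * σ.length + 3) with hx
    have hpow : (4 : ℝ) ^ σ.length * (1 / 2) ^ (2 * σ.length + 3) = 1 / 8 := by
      rw [pow_add, pow_mul, ← mul_assoc, ← mul_pow]; norm_num
    have hfl : (⌊4 ^ σ.length * ratVal x⌋₊ : ℝ) + 5 = q σ := by
      have h1 : 4 ^ σ.length * ratVal x =
          ((x.1 * 2 ^ (2 * σ.length) : ℕ) : ℝ) / ((x.2 + 1 : ℕ) : ℝ) := by
        rw [ratVal, pow_mul]; push_cast; ring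
      rw [h1, Nat.floor_div_eq_div]
      simp [q, ← hx]
    have hx0 : 0 ≤ 4 ^ σ.length * ratVal x := by unfold ratVal; positivity
    have h1 := Nat.floor_le hx0
    have h2 := Nat.lt_floor_add_one (4 ^ σ.length * ratVal x)
    rw [abs_le] at h
    have hp : (0 : ℝ) < 4 ^ σ.length := by positivity
    have h3 := mul_le_mul_of_nonneg_left h.1 hp.le
    have h4 := mul_le_mul_of_nonneg_left h.2 hp.le
    rw [mul_neg, hpow, mul_sub] at h3
    rw [hpow, mul_sub] at h4
    constructor <;> linarith
  refine ⟨q, ?_, ?_, fun σ => ?_, fun σ => by linarith [(hq σ).1]⟩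
  · have hl : Computable fun σ : List Bool => 2 * σ.length :=
      Primrec.nat_mul.to_comp.comp (Computable.const 2) Computable.list_length
    have hx : Computable fun σ : List Bool => a (σ, 2 * σ.length + 3) :=
      ha.comp (Computable.id.pair (Primrec.nat_add.to_comp.comp hl (Computable.const 3)))
    refine Primrec.nat_add.to_comp.comp (Primrec.nat_div.to_comp.comp ?_ ?_) (Computable.const 5)
    · exact Primrec.nat_mul.to_comp.comp (Computable.fst.comp hx) (computable_two_pow.comp hl)
    · exact Computable.succ.comp (Computable.snd.comp hx)
  · have h := (hq []).2
    have := hP.root_le_one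
    simp only [List.length_nil, pow_zero, one_mul] at h
    have h8 : (q [] : ℝ) < 8 := by linarith
    exact_mod_cast h8.le
  · have h0 := (hq (σ ++ [false])).2
    have h1 := (hq (σ ++ [true])).2
    have h2 := (hq σ).1
    have h3 := mul_le_mul_of_nonneg_left (hP.split σ)
      (show (0 : ℝ) ≤ 4 * 4 ^ σ.length by positivity)
    simp only [List.length_append, List.length_singleton, pow_succ] at h0 h1
    have : (q (σ ++ [false]) + q (σ ++ [true]) : ℝ) ≤ 4 * q σ := by linarith
    exact_mod_cast this

/-- One step of the allocation: a string `σ` that owns `N` cells, and the position `r < N` of the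
oracle among them. Two further bits `d < 4` of the oracle split every cell into four; the first
`q (σ1)` of the `4 N` new cells go to `σ1` and the remaining ones to `σ0`. -/
def allocStep (q : List Bool → ℕ) (s : List Bool × ℕ × ℕ) (d : ℕ) : List Bool × ℕ × ℕ :=
  bif decide (4 * s.2.2 + d < q (s.1 ++ [true])) then
    (s.1 ++ [true], q (s.1 ++ [true]), 4 * s.2.2 + d)
  else
    (s.1 ++ [false], 4 * s.2.1 - q (s.1 ++ [true]), 4 * s.2.2 + d - q (s.1 ++ [true]))

/-- The string, its number of cells and the position after `n` steps, on the oracle `b`, of which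
`2 n + 3` bits have been read; the empty string owns `8` cells. -/
def alloc (q : List Bool → ℕ) (b : Cantor) : ℕ → List Bool × ℕ × ℕ
  | 0 => ([], 8, 4 * (b 0).toNat + 2 * (b 1).toNat + (b 2).toNat)
  | n + 1 => allocStep q (alloc q b n) (2 * (b (2 * n + 3)).toNat + (b (2 * n + 4)).toNat)

theorem alloc_congr (q : List Bool → ℕ) {b b' : Cantor} {n : ℕ}
    (h : ∀ i < 2 * n + 3, b i = b' i) : alloc q b n = alloc q b' n := by
  induction n with
  | zero => simp [alloc, h 0, h 1, h 2]
  | succ n ih =>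
    rw [alloc, alloc, ih fun i hi => h i (by omega), h _ (by omega), h _ (by omega)]

theorem allocStep_fst (q : List Bool → ℕ) (s : List Bool × ℕ × ℕ) (d : ℕ) :
    (allocStep q s d).1 = s.1 ++ [decide (4 * s.2.2 + d < q (s.1 ++ [true]))] := by
  unfold allocStep
  cases decide (4 * s.2.2 + d < q (s.1 ++ [true])) <;> rfl

theorem computable_alloc {q : List Bool → ℕ} (hq : Computable q) :
    Computable₂ fun (n : ℕ) (ρ : List Bool) => alloc q (padZeros ρ) n := by
  have hbit : Computable₂ fun (ρ : List Bool) (i : ℕ) => (padZeros ρ i).toNat :=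
    (Primrec.dom_bool Bool.toNat).to_comp.comp (Primrec.list_getD false).to_comp
  have hb : ∀ {α : Type} [Primcodable α] {ρ : α → List Bool} {i : α → ℕ} (c : ℕ), Computable ρ →
      Computable i → Computable fun a => c * (padZeros (ρ a) (i a)).toNat :=
    fun c hρ hi => Primrec.nat_mul.to_comp.comp (Computable.const c) (hbit.comp hρ hi)
  have hstep : Computable₂ (allocStep q) := by
    have hσ : Computable fun x : (List Bool × ℕ × ℕ) × ℕ => x.1.1 :=
      Computable.fst.comp Computable.fst
    have h1 : Computable fun x : (List Bool × ℕ × ℕ) × ℕ => x.1.1 ++ [true] :=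
      Computable.list_concat.comp hσ (Computable.const true)
    have h0 : Computable fun x : (List Bool × ℕ × ℕ) × ℕ => x.1.1 ++ [false] :=
      Computable.list_concat.comp hσ (Computable.const false)
    have hN : Computable fun x : (List Bool × ℕ × ℕ) × ℕ => 4 * x.1.2.1 :=
      Primrec.nat_mul.to_comp.comp (Computable.const 4)
        (Computable.fst.comp (Computable.snd.comp Computable.fst))
    have hr : Computable fun x : (List Bool × ℕ × ℕ) × ℕ => 4 * x.1.2.2 + x.2 :=
      Primrec.nat_add.to_comp.comp (Primrec.nat_mul.to_comp.comp (Computable.const 4)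
        (Computable.snd.comp (Computable.snd.comp Computable.fst))) Computable.snd
    have hq1 := hq.comp h1
    exact Computable.cond (Primrec.nat_lt.decide.to_comp.comp hr hq1)
      (h1.pair (hq1.pair hr))
      (h0.pair ((Primrec.nat_sub.to_comp.comp hN hq1).pair (Primrec.nat_sub.to_comp.comp hr hq1)))
  have h : Computable fun x : ℕ × List Bool =>
      Nat.rec (motive := fun _ => List Bool × ℕ × ℕ)
        ([], 8, 4 * (padZeros x.2 0).toNat + 2 * (padZeros x.2 1).toNat +
          1 * (padZeros x.2 2).toNat)
        (fun n s => allocStep q s (2 * (padZeros x.2 (2 * n + 3)).toNat +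
          1 * (padZeros x.2 (2 * n + 4)).toNat)) x.1 := by
    refine Computable.nat_rec (f := fun x : ℕ × List Bool => x.1)
      (g := fun x => (([], 8, 4 * (padZeros x.2 0).toNat + 2 * (padZeros x.2 1).toNat +
          1 * (padZeros x.2 2).toNat) : List Bool × ℕ × ℕ))
      (h := fun x s => allocStep q s.2 (2 * (padZeros x.2 (2 * s.1 + 3)).toNat +
          1 * (padZeros x.2 (2 * s.1 + 4)).toNat)) Computable.fst ?_ ?_
    · refine (Computable.const []).pair ((Computable.const 8).pair ?_)
      exact Primrec.nat_add.to_comp.comp (Primrec.nat_add.to_comp.comp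
        (hb 4 Computable.snd (Computable.const 0)) (hb 2 Computable.snd (Computable.const 1)))
        (hb 1 Computable.snd (Computable.const 2))
    · have hρ : Computable fun y : (ℕ × List Bool) × ℕ × List Bool × ℕ × ℕ => y.1.2 :=
        Computable.snd.comp Computable.fst
      have hi : ∀ c, Computable fun y : (ℕ × List Bool) × ℕ × List Bool × ℕ × ℕ =>
          2 * y.2.1 + c := fun c =>
        Primrec.nat_add.to_comp.comp (Primrec.nat_mul.to_comp.comp (Computable.const 2)
          (Computable.fst.comp Computable.snd)) (Computable.const c)
      exact hstep.comp (Computable.snd.comp Computable.snd)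
        (Primrec.nat_add.to_comp.comp (hb 2 hρ (hi 3)) (hb 1 hρ (hi 4)))
  refine h.of_eq fun x => ?_
  obtain ⟨n, ρ⟩ := x
  induction n with
  | zero => simp [alloc]
  | succ n ih =>
    simp only [one_mul] at ih ⊢
    rw [alloc, ← ih]

/-- The truth-table map that allocates cells according to `q`. -/
def allocMap {q : List Bool → ℕ} (hq : Computable q) : TTMap where
  use n := 2 * n + 3
  table n ρ := (alloc q (padZeros ρ) n).1
  toFun b n := decide (4 * (alloc q b n).2.2 +
    (2 * (b (2 * n + 3)).toNat + (b (2 * n + 4)).toNat) < q ((alloc q b n).1 ++ [true]))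
  use_computable := Primrec.nat_add.to_comp.comp (Primrec.nat_mul.to_comp.comp
    (Computable.const 2) Computable.id) (Computable.const 3)
  table_computable := Computable.fst.comp (computable_alloc hq)
  prefixOf_toFun b n := by
    rw [alloc_congr q (b' := b)]
    · induction n with
      | zero => rfl
      | succ n ih => rw [prefixOf_succ, ih, alloc, allocStep_fst]
    · have := prefixOf_padZeros (prefixOf b (2 * n + 3))
      rw [length_prefixOf] at this
      exact prefixOf_eq_iff.1 this

/-- Every string `σ` receives at least `q σ` cells, and each of its cells is reached by some
oracle. -/
theorem exists_alloc_eq {q : List Bool → ℕ} (h8 : q [] ≤ 8)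
    (hq : ∀ σ, q (σ ++ [false]) + q (σ ++ [true]) ≤ 4 * q σ) (σ : List Bool) :
    ∃ N, q σ ≤ N ∧ ∀ r < N, ∃ b, alloc q b σ.length = (σ, N, r) := by
  induction σ using List.reverseRecOn with
  | nil =>
    refine ⟨8, h8, fun r hr => ⟨fun i => if i = 0 then decide (4 ≤ r) else
      if i = 1 then decide (2 ≤ r % 4) else decide (r % 2 = 1), ?_⟩⟩
    interval_cases r <;> rfl
  | append_singleton σ c ih =>
    obtain ⟨N, hN, hσ⟩ := ih
    have hq' := hq σ
    have key : ∀ r < 4 * N, ∃ b, alloc q b (σ.length + 1) =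
        allocStep q (σ, N, r / 4) (r % 4) := by
      intro r hr
      obtain ⟨b, hb⟩ := hσ (r / 4) (by omega)
      refine ⟨fun i => if i = 2 * σ.length + 3 then decide (2 ≤ r % 4) else
        if i = 2 * σ.length + 4 then decide (r % 2 = 1) else b i, ?_⟩
      rw [alloc, alloc_congr q (b' := b) fun i hi => by
        rw [if_neg (by omega), if_neg (by omega)], hb]
      congr 1
      have h4 : r % 4 < 4 := Nat.mod_lt _ (by norm_num)
      have h2 : r % 2 = r % 4 % 2 := by omega
      simp only [if_true, h2, show 2 * σ.length + 4 ≠ 2 * σ.length + 3 by omega, if_false]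
      generalize r % 4 = d at h4
      interval_cases d <;> rfl
    rw [List.length_append, List.length_singleton]
    cases c with
    | true =>
      refine ⟨q (σ ++ [true]), le_rfl, fun r hr => ?_⟩
      obtain ⟨b, hb⟩ := key r (by omega)
      refine ⟨b, ?_⟩
      rw [hb, allocStep]
      simp [Nat.div_add_mod, hr]
    | false =>
      refine ⟨4 * N - q (σ ++ [true]), by omega, fun r hr => ?_⟩
      obtain ⟨b, hb⟩ := key (r + q (σ ++ [true])) (by omega)
      refine ⟨b, ?_⟩
      rw [hb, allocStep]
      simp [Nat.div_add_mod]

theorem le_count_allocMap {q : List Bool → ℕ} (hc : Computable q) (h8 : q [] ≤ 8)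
    (hq : ∀ σ, q (σ ++ [false]) + q (σ ++ [true]) ≤ 4 * q σ) (σ : List Bool) :
    q σ ≤ (allocMap hc).count σ := by
  obtain ⟨N, hN, hσ⟩ := exists_alloc_eq h8 hq σ
  refine hN.trans ?_
  have : ∀ r, ∃ b, r < N → alloc q b σ.length = (σ, N, r) := fun r => by
    by_cases hr : r < N
    · exact (hσ r hr).imp fun b hb _ => hb
    · exact ⟨padZeros [], fun h => absurd h hr⟩
  choose b hb using this
  let l := (List.range N).map fun r => prefixOf (b r) (2 * σ.length + 3)
  have hl : l.Nodup := by
    refine List.Nodup.map_on (fun r hr r' hr' h => ?_) List.nodup_range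
    have := alloc_congr q (prefixOf_eq_iff.1 h)
    rw [hb r (List.mem_range.1 hr), hb r' (List.mem_range.1 hr')] at this
    simpa using this
  have hsub : l ⊆ (strings ((allocMap hc).use σ.length)).filter
      fun ρ => decide ((allocMap hc).table σ.length ρ = σ) := by
    intro ρ hρ
    obtain ⟨r, hr, rfl⟩ := List.mem_map.1 hρ
    refine List.mem_filter.2 ⟨mem_strings.2 (length_prefixOf _ _), ?_⟩
    rw [decide_eq_true_eq]
    have := hb r (List.mem_range.1 hr)
    rw [← alloc_congr q (b := padZeros (prefixOf (b r) (2 * σ.length + 3)))] at this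
    · exact congrArg Prod.fst this
    · have := prefixOf_padZeros (prefixOf (b r) (2 * σ.length + 3))
      rw [length_prefixOf] at this
      exact prefixOf_eq_iff.1 this
  have := (List.subperm_of_subset hl hsub).length_le
  rw [← List.countP_eq_length_filter] at this
  rwa [List.length_map, List.length_range] at this

/-- Every computable semimeasure is dominated by the image of Lebesgue measure under some
truth-table map. -/
theorem IsContinuousSemimeasure.exists_ttMap_le {P : List Bool → ℝ}
    (hP : IsContinuousSemimeasure P) (hP' : IsComputable P) :
    ∃ G : TTMap, ∀ σ, P σ ≤ 8 * lebesgue.real (G.preimage σ) := by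
  obtain ⟨q, hc, h8, hq, hqP⟩ := exists_nat_majorant hP hP'
  refine ⟨allocMap hc, fun σ => ?_⟩
  have h1 : (q σ : ℝ) ≤ (allocMap hc).count σ := by exact_mod_cast le_count_allocMap hc h8 hq σ
  have h2 := (hqP σ).trans h1
  have h3 : (2 : ℝ) ^ (allocMap hc).use σ.length = 8 * 4 ^ σ.length := by
    change (2 : ℝ) ^ (2 * σ.length + 3) = _
    rw [pow_add, pow_mul]; norm_num; ring
  rw [TTMap.lebesgue_real_preimage, h3, mul_div_assoc', mul_div_mul_left _ _ (by norm_num),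
    le_div_iff₀ (by positivity)]
  linarith

/-! ### Weak depth and computable semimeasures -/

/-- If the preimages of the prefixes of `X` are eventually contained in each component of a test,
then `M` exceeds the image measure by arbitrarily large factors along `X`. -/
theorem IsUniversalSemimeasure.eventually_mul_lt {M : List Bool → ℝ}
    (hM : IsUniversalSemimeasure M) {W : ℕ → List Bool → Prop} (hW : IsMLTest W) (G : TTMap)
    {X : Cantor} (h : ∀ i, ∃ n, G.preimage (prefixOf X n) ⊆ openOf (W i)) (A : ℝ) :
    ∀ᶠ n in atTop, A * lebesgue.real (G.preimage (prefixOf X n)) < M (prefixOf X n) := by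
  obtain ⟨C, hC⟩ := hM.exists_preimage_le hW G
  obtain ⟨j, hj⟩ := pow_unbounded_of_one_lt (max C 0 * A) one_lt_two
  obtain ⟨n₀, hn₀⟩ := h (2 * j)
  filter_upwards [eventually_ge_atTop n₀] with n hn
  have hsub : G.preimage (prefixOf X n) ⊆ openOf (W (2 * j)) := by
    refine Set.Subset.trans (fun Y hY => ?_) hn₀
    rw [G.mem_preimage_prefixOf] at hY ⊢
    rw [← take_prefixOf _ hn, hY, take_prefixOf _ hn]
  have h1 := hC j _ hsub
  have hpos := hM.pos (prefixOf X n)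
  by_contra! hle
  have h0 : 0 ≤ lebesgue.real (G.preimage (prefixOf X n)) := measureReal_nonneg
  have hμ : 0 < lebesgue.real (G.preimage (prefixOf X n)) := by
    refine h0.lt_of_ne fun h => ?_
    rw [← h, mul_zero] at hle
    exact hle.not_gt hpos
  have h2 : C * M (prefixOf X n) ≤ max C 0 * M (prefixOf X n) :=
    mul_le_mul_of_nonneg_right (le_max_left _ _) hpos.le
  have h3 := mul_le_mul_of_nonneg_left hle (le_max_right C 0)
  have h4 := mul_lt_mul_of_pos_right hj hμ
  rw [mul_assoc] at h4
  linarith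

/-- The deficiency test of the identity map is universal. -/
theorem mem_openOf_deficiencyTest_of_not_mlRandom {M : List Bool → ℝ}
    (hM : IsUniversalSemimeasure M) {Y : Cantor} (hY : ¬ MLRandom Y) (i : ℕ) :
    Y ∈ openOf (deficiencyTest M TTMap.id i) := by
  unfold MLRandom at hY
  push Not at hY
  obtain ⟨W, hW, hYW⟩ := hY
  rw [Set.mem_iInter] at hYW
  rw [mem_openOf_deficiencyTest]
  refine (hM.eventually_mul_lt hW TTMap.id (fun i => ?_) (2 ^ i)).exists
  obtain ⟨n, hn⟩ := hYW i
  refine ⟨n, fun Z hZ => ⟨n, ?_⟩⟩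
  rw [TTMap.mem_preimage_prefixOf] at hZ
  exact hZ.symm ▸ hn

theorem WeaklyDeep.eventually_mul_lt {M : List Bool → ℝ} (hM : IsUniversalSemimeasure M)
    {X : Cantor} (hX : WeaklyDeep X) {P : List Bool → ℝ} (hP : IsContinuousSemimeasure P)
    (hP' : IsComputable P) (C : ℝ) : ∀ᶠ n in atTop, C * P (prefixOf X n) < M (prefixOf X n) := by
  obtain ⟨G, hG⟩ := hP.exists_ttMap_le hP'
  refine (hM.eventually_mul_lt (isMLTest_deficiencyTest hM.semimeasure hM.lowerSemicomputable
    TTMap.id) G (X := X) (fun i => ?_) (|C| * 8)).mono fun n hn => lt_of_le_of_lt ?_ hn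
  · -- No oracle that `G` maps to `X` is random; compactness gives a single prefix of `X`.
    let O : ℕ → Set Cantor := fun n =>
      (G.preimage (prefixOf X n))ᶜ ∪ openOf (deficiencyTest M TTMap.id i)
    have hO : ∀ n, IsOpen (O n) := fun n =>
      (G.isClosed_preimage _).isOpen_compl.union (isOpen_openOf _)
    have hmono : Monotone O := by
      intro m n hmn
      refine Set.union_subset_union_left _ (Set.compl_subset_compl.2 fun Y hY => ?_)
      rw [G.mem_preimage_prefixOf] at hY ⊢
      rw [← take_prefixOf _ hmn, hY, take_prefixOf _ hmn]
    have hcover : (Set.univ : Set Cantor) ⊆ ⋃ n, O n := by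
      intro Y _
      by_cases hY : G.toFun Y = X
      · refine Set.mem_iUnion.2 ⟨0, Or.inr (mem_openOf_deficiencyTest_of_not_mlRandom hM ?_ i)⟩
        exact fun hr => hX ⟨Y, hr, hY ▸ G.ttReducible Y⟩
      · obtain ⟨n, hn⟩ := Function.ne_iff.1 hY
        refine Set.mem_iUnion.2 ⟨n + 1, Or.inl fun h => hn ?_⟩
        exact prefixOf_eq_iff.1 (G.mem_preimage_prefixOf.1 h) n (Nat.lt_succ_self n)
    obtain ⟨n, hn⟩ := isCompact_univ.elim_directed_cover O hO hcover hmono.directed_le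
    exact ⟨n, fun Y hY => (hn (Set.mem_univ Y)).resolve_left fun h => h hY⟩
  · rw [mul_assoc]
    exact mul_le_mul (le_abs_self C) (hG _) (hP.nonneg _) (abs_nonneg C)

end Depth

theorem mainTheorem4 (M : List Bool → ℝ) (hM : Depth.IsUniversalSemimeasure M)
    (U : Depth.TuringFunctional) (hU : U.IsUniversal) (X : Depth.Cantor) :
    (Depth.WeaklyDeep X ↔
      ∀ P : List Bool → ℝ, Depth.IsContinuousSemimeasure P → Depth.IsComputable P →
        Tendsto (fun n => ENNReal.ofReal (M (Depth.prefixOf X n)) /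
          ENNReal.ofReal (P (Depth.prefixOf X n))) atTop (𝓝 ⊤)) ∧
    (Depth.KADeep M U X ↔ Depth.WeaklyDeep X) := by
  have key : ∀ P : List Bool → ℝ, Depth.IsContinuousSemimeasure P →
      (Tendsto (fun n => ENNReal.ofReal (M (Depth.prefixOf X n)) /
        ENNReal.ofReal (P (Depth.prefixOf X n))) atTop (𝓝 ⊤) ↔
      ∀ C : ℝ, ∀ᶠ n in atTop, C * P (Depth.prefixOf X n) < M (Depth.prefixOf X n)) :=
    fun P hP => Depth.tendsto_ofReal_div_nhds_top_iff
      (m := fun n => M (Depth.prefixOf X n)) (p := fun n => P (Depth.prefixOf X n))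
      (fun _ => hM.pos _) fun _ => hP.nonneg _
  have h3 : Depth.KADeep M U X → Depth.WeaklyDeep X := fun h => h.weaklyDeep hM hU
  have h2 : (∀ P : List Bool → ℝ, Depth.IsContinuousSemimeasure P → Depth.IsComputable P →
      Tendsto (fun n => ENNReal.ofReal (M (Depth.prefixOf X n)) /
        ENNReal.ofReal (P (Depth.prefixOf X n))) atTop (𝓝 ⊤)) → Depth.KADeep M U X := by
    intro h
    rw [Depth.kaDeep_iff hM]
    intro t ht
    have hP := U.isContinuousSemimeasure_timeBounded ht.2
    exact (key _ hP).1 (h _ hP (U.isComputable_timeBounded ht))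
  have h1 : Depth.WeaklyDeep X → ∀ P : List Bool → ℝ,
      Depth.IsContinuousSemimeasure P → Depth.IsComputable P →
      Tendsto (fun n => ENNReal.ofReal (M (Depth.prefixOf X n)) /
        ENNReal.ofReal (P (Depth.prefixOf X n))) atTop (𝓝 ⊤) := by
    intro hX P hP hP'
    rw [key P hP]
    exact hX.eventually_mul_lt hM hP hP'
  exact ⟨⟨h1, fun h => h3 (h2 h)⟩, ⟨h3, fun h => h2 (h1 h)⟩⟩
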